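/- All graphs are finite and simple, and $e(G)$ denotes the number of edges of $G$. A graph $G$ is \emph{$k$-connected} if it has at least $k+1$ vertices and $G-U$ is connected for every set $U$ of at most $k-1$ vertices. An edge-colouring of a graph $G$ is \emph{monochromatic $k$-connected} if any two distinct vertices of $G$ are connected by $k$ different, internally vertex-disjoint paths, each of which has all of its edges of the same colour (different paths may have different colours). For a $k$-connected graph $G$, the \emph{monochromatic $k$-connection number} $mc_k(G)$ is the maximum number of colours used by a monochromatic $k$-connected edge-colouring of $G$. \textbf{Theorem.} Let $k\in\{2,3,4,5\}$ and $n>k$, and let $G$ be a $k$-connected graph on $n$ vertices. Then $G$ has a monochromatic $k$-connected edge-colouring (so $mc_k(G)$ is well defined), and \[ mc_k(G)\le e(G)-\left\lceil\frac{kn}{2}\right\rceil+1 . \] If moreover $G$ has a spanning $k$-connected subgraph with exactly $\left\lceil\frac{kn}{2}\right\rceil$ edges, then \[ mc_k(G)=e(G)-\left\lceil\frac{kn}{2}\right\rceil+1 . \] -/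

import Mathlib

namespace MonoConn

/-- A finite graph is `k`-connected (`k ≥ 1`) if it has at least `k + 1` vertices, and it remains
connected after the deletion of any set of at most `k - 1` vertices. -/
def IsKConnected {V : Type*} [Fintype V] (G : SimpleGraph V) (k : ℕ) : Prop :=
  k + 1 ≤ Fintype.card V ∧
    ∀ U : Finset V, U.card < k → (G.induce {v : V | v ∉ U}).Connected

/-- All edges of the walk `p` have the same colour in the edge-colouring `φ`. -/
def IsMonochromatic {V K : Type*} {G : SimpleGraph V} (φ : G.EdgeLabeling K) {u v : V}
    (p : G.Walk u v) : Prop :=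
  ∃ c : K, ∀ (e : Sym2 V) (he : e ∈ p.edges), φ ⟨e, p.edges_subset_edgeSet he⟩ = c

/-- The edge-colouring `φ` of `G` is monochromatic `k`-connected: any two distinct vertices are
connected by `k` (different) internally vertex-disjoint monochromatic paths. -/
def IsMonoKConnected {V K : Type*} {G : SimpleGraph V} (φ : G.EdgeLabeling K) (k : ℕ) : Prop :=
  ∀ u v : V, u ≠ v → ∃ P : Fin k → G.Path u v,
    Function.Injective P ∧
    (∀ i, IsMonochromatic φ (P i : G.Walk u v)) ∧
    ∀ i j, i ≠ j → ∀ x : V, x ∈ (P i : G.Walk u v).support → x ∈ (P j : G.Walk u v).support →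
      x = u ∨ x = v

/-- The set of all `r` such that `G` has a monochromatic `k`-connected edge-colouring that uses
exactly `r` colours. -/
def colourNumbers {V : Type*} (G : SimpleGraph V) (k : ℕ) : Set ℕ :=
  {r : ℕ | ∃ φ : G.EdgeLabeling (Fin r), Function.Surjective φ ∧ IsMonoKConnected φ k}

/-- The monochromatic `k`-connection number `mc_k(G)`: the maximum number of colours in a
monochromatic `k`-connected edge-colouring of `G`. -/
noncomputable def mc {V : Type*} (G : SimpleGraph V) (k : ℕ) : ℕ :=
  sSup (colourNumbers G k)

/-- The number of colours is bounded by the number of edges. -/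
theorem bddAbove_colourNumbers {V : Type*} [Finite V] (G : SimpleGraph V) (k : ℕ) :
    BddAbove (colourNumbers G k) := by
  refine ⟨Nat.card G.edgeSet, ?_⟩
  rintro r ⟨φ, hφ, -⟩
  have h := Nat.card_le_card_of_surjective (fun e : G.edgeSet => φ e) hφ
  simpa using h

/-- As soon as one monochromatic `k`-connected colouring exists, `mc G k` is a true maximum. -/
theorem isGreatest_mc {V : Type*} [Finite V] (G : SimpleGraph V) (k : ℕ)
    (h : (colourNumbers G k).Nonempty) : IsGreatest (colourNumbers G k) (mc G k) :=
  ⟨Nat.sSup_mem h (bddAbove_colourNumbers G k),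
    fun _ hr => le_csSup (bddAbove_colourNumbers G k) hr⟩

end MonoConn

/-! Lower bound: give all edges of a spanning k-connected subgraph `H` one colour and every other
edge its own colour. Menger's theorem (`linked_of_le_card_separator`, `IsKConnected.exists_paths`)
finds the required paths inside `H`, so e(G) - e(H) + 1 colours are possible.

Upper bound: split the colour classes into connected components. Every colour owns at least one
component with an edge, so it suffices that Σ (2e - 2) ≥ kn - 2 over the components with at least
two edges. The paths between `u` and `v` leave each end by different edges, and a one-edge component
can only contribute the edge `uv`. Hence Σ min(deg_i u, deg_i v) ≥ k - 1, and ≥ k if `uv` lies in a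
large component. These conditions form an `IsSystem`.

Fix `v` and let d(w) be the degree of `w` in the components meeting `v`. Always d(w) ≥ k - 1, and
the components missing `v` pay for the vertices with equality (`card_bad_le_sum_outer`). The sum is
therefore at least kn - 2c(v) plus the excess of `d` over `k`, where c(v) is the number of
components at `v` (`IsSystem.le_waste`). This settles c(v) ≤ 1, and also the case where `v` has
total degree `k` and is a leaf of some component, since a leaf forces excess elsewhere.

For k ≤ 5 an averaging argument shows that a counterexample has a vertex of total degree `k`.
Further counting leaves exactly two components, both spanning, with all total degrees `k` except
possibly at one vertex `z` (`exists_structure`). The degree inequalities alone do not exclude this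
case. The paths themselves do: degrees in each component are constant off `z`, one component is
2-regular off `z`, and its path segments would close up without reaching `z` (`deg_eq_deg`,
`false_of_degree_two`). -/

set_option linter.unusedSectionVars false

/-! ### Menger's theorem. -/

namespace SimpleGraph
open Function

variable {V : Type*}

/-- There is a walk in `G` from `a` to `b` avoiding `S`. -/
def ReachableAvoiding (G : SimpleGraph V) (S : Set V) (a b : V) : Prop :=
  ∃ p : G.Walk a b, ∀ z ∈ p.support, z ∉ S

/-- Every walk of `G` from `A` to `B` meets `X`. -/
def Separates (G : SimpleGraph V) (A B X : Set V) : Prop :=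
  ∀ a ∈ A, ∀ b ∈ B, ∀ p : G.Walk a b, ∃ x ∈ X, x ∈ p.support

/-- There are `k` pairwise disjoint paths of `G` from `A` to `B`. -/
def Linked (G : SimpleGraph V) (A B : Set V) (k : ℕ) : Prop :=
  ∃ Q : Fin k → Set V, Pairwise (Disjoint on Q) ∧
    ∀ i, ∃ a ∈ A, ∃ b ∈ B, ∃ p : G.Walk a b, p.IsPath ∧ ∀ x ∈ p.support, x ∈ Q i

theorem Separates.symm {G : SimpleGraph V} {A B X : Set V} (h : G.Separates A B X) :
    G.Separates B A X := by
  intro b hb a ha p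
  obtain ⟨x, hx, hxp⟩ := h a ha b hb p.reverse
  exact ⟨x, hx, by simpa using hxp⟩

theorem ReachableAvoiding.symm {G : SimpleGraph V} {S : Set V} {a b : V}
    (h : G.ReachableAvoiding S a b) : G.ReachableAvoiding S b a := by
  obtain ⟨p, hp⟩ := h
  exact ⟨p.reverse, fun z hz => hp z (by simpa using hz)⟩

theorem ReachableAvoiding.trans {G : SimpleGraph V} {S : Set V} {a b c : V}
    (h : G.ReachableAvoiding S a b) (h' : G.ReachableAvoiding S b c) :
    G.ReachableAvoiding S a c := by
  obtain ⟨p, hp⟩ := h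
  obtain ⟨q, hq⟩ := h'
  refine ⟨p.append q, fun z hz => ?_⟩
  rcases (Walk.mem_support_append_iff _ _).1 hz with h | h
  exacts [hp z h, hq z h]

theorem ReachableAvoiding.refl {G : SimpleGraph V} {S : Set V} {a : V} (h : a ∉ S) :
    G.ReachableAvoiding S a a := ⟨.nil, by simpa using h⟩

theorem ReachableAvoiding.head {G : SimpleGraph V} {S : Set V} {a b c : V} (hab : G.Adj a b)
    (ha : a ∉ S) (h : G.ReachableAvoiding S b c) : G.ReachableAvoiding S a c := by
  obtain ⟨p, hp⟩ := h
  refine ⟨.cons hab p, ?_⟩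
  simpa using ⟨ha, hp⟩

theorem Separates.not_reachableAvoiding {G : SimpleGraph V} {A B S : Set V}
    (h : G.Separates A B S) {a b : V} (ha : a ∈ A) (hb : b ∈ B) :
    ¬ G.ReachableAvoiding S a b := by
  rintro ⟨p, hp⟩
  obtain ⟨x, hx, hxp⟩ := h a ha b hb p
  exact hp x hxp hx

/-- The part of the walk between the first and last use of the edge is cut out. -/
theorem exists_reachableAvoiding_of_walk {G : SimpleGraph V} {u v : V} {S : Set V} {a b : V}
    (p : G.Walk a b) (hp : ∀ z ∈ p.support, z ∉ S) :
    (G.deleteEdges {s(u, v)}).ReachableAvoiding S a b ∨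
    ∃ x y, s(x, y) = s(u, v) ∧ (G.deleteEdges {s(u, v)}).ReachableAvoiding S a x ∧
      (G.deleteEdges {s(u, v)}).ReachableAvoiding S y b := by
  induction p with
  | nil => exact .inl (.refl (hp _ (by simp)))
  | @cons a c b h q ih =>
    have ha : a ∉ S := hp a (by simp)
    have hq : ∀ z ∈ q.support, z ∉ S := fun z hz => hp z (by simp [hz])
    have hc : c ∉ S := hq c (by simp)
    by_cases he : s(a, c) = s(u, v)
    · rcases ih hq with h1 | ⟨x, y, hxy, hx, hy⟩
      · exact .inr ⟨a, c, he, .refl ha, h1⟩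
      · have : s(x, y) = s(a, c) := hxy.trans he.symm
        rcases Sym2.eq_iff.1 this with ⟨rfl, rfl⟩ | ⟨rfl, rfl⟩
        · exact .inr ⟨x, y, he, .refl ha, hy⟩
        · exact .inl hy
    · have hadj : (G.deleteEdges {s(u, v)}).Adj a c := by simp [deleteEdges_adj, h, he]
      rcases ih hq with h1 | ⟨x, y, hxy, hx, hy⟩
      · exact .inl (.head hadj ha h1)
      · exact .inr ⟨x, y, hxy, .head hadj ha hx, hy⟩

/-- The walk is followed until it meets `insert x S` or is about to use the edge. It would have
stopped at `x`, so the edge is first approached from `y`. -/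
theorem exists_walk_to_insert {G : SimpleGraph V} {x y : V} {S : Set V} (hy : y ∉ S) {a b : V}
    (p : G.Walk a b) (hp : ∃ z ∈ insert x S, z ∈ p.support) :
    (∃ w ∈ insert x S, ∃ q : (G.deleteEdges {s(x, y)}).Walk a w, ∀ z ∈ q.support, z ∈ p.support) ∨
      (G.deleteEdges {s(x, y)}).ReachableAvoiding S a y := by
  induction p with
  | @nil a =>
    obtain ⟨z, hz, hzp⟩ := hp
    simp only [Walk.support_nil, List.mem_singleton] at hzp
    subst hzp
    exact .inl ⟨z, hz, .nil, by simp⟩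
  | @cons a c b h q ih =>
    by_cases ha : a ∈ insert x S
    · exact .inl ⟨a, ha, .nil, by simp⟩
    have hq : ∃ z ∈ insert x S, z ∈ q.support := by
      obtain ⟨z, hz, hzp⟩ := hp
      refine ⟨z, hz, ?_⟩
      rcases (by simpa using hzp : z = a ∨ z ∈ q.support) with rfl | h
      exacts [absurd hz ha, h]
    by_cases he : s(a, c) = s(x, y)
    · rcases Sym2.eq_iff.1 he with ⟨rfl, rfl⟩ | ⟨rfl, rfl⟩
      · exact absurd (Set.mem_insert _ _) ha
      · exact .inr (.refl hy)
    · have hadj : (G.deleteEdges {s(x, y)}).Adj a c := by simp [deleteEdges_adj, h, he]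
      rcases ih hq with ⟨w, hw, r, hr⟩ | h1
      · refine .inl ⟨w, hw, .cons hadj r, ?_⟩
        intro z hz
        rcases (by simpa using hz : z = a ∨ z ∈ r.support) with rfl | h
        · simp
        · simp [hr z h]
      · exact .inr (.head hadj (fun h => ha (Set.mem_insert_of_mem _ h)) h1)

/-- Disjoint paths have distinct ends, so |X| paths use every point of `X` once and can be indexed
by their ends. -/
theorem Linked.exists_family {G : SimpleGraph V} {A : Set V} {X : Finset V} {k : ℕ}
    (h : G.Linked A X k) (hX : X.card = k) :
    ∃ Q : V → Set V, (X : Set V).PairwiseDisjoint Q ∧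
      ∀ x ∈ X, ∃ a ∈ A, ∃ p : G.Walk a x, p.IsPath ∧ ∀ z, z ∈ p.support ↔ z ∈ Q x := by
  classical
  obtain ⟨Q, hQ, hp⟩ := h
  choose a ha b hb p hpath hpQ using hp
  have hbQ : ∀ i, b i ∈ Q i := fun i => hpQ i _ (Walk.end_mem_support _)
  have hinj : Injective b := by
    intro i j hij
    by_contra hne
    exact Set.disjoint_left.1 (hQ hne) (hbQ i) (hij ▸ hbQ j)
  have himg : Finset.univ.image b = X := by
    apply Finset.eq_of_subset_of_card_le
    · intro x hx
      obtain ⟨i, -, rfl⟩ := Finset.mem_image.1 hx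
      exact hb i
    · rw [Finset.card_image_of_injective _ hinj, hX]; simp
  have hsurj : ∀ x ∈ X, ∃ i, b i = x := by
    intro x hx
    rw [← himg] at hx
    simpa using hx
  refine ⟨fun x => {z | ∃ i, b i = x ∧ z ∈ (p i).support}, ?_, ?_⟩
  · intro x hx y hy hxy
    refine Set.disjoint_left.2 ?_
    rintro z ⟨i, rfl, hi⟩ ⟨j, rfl, hj⟩
    have hne : i ≠ j := fun h => hxy (h ▸ rfl)
    exact Set.disjoint_left.1 (hQ hne) (hpQ i z hi) (hpQ j z hj)
  · intro x hx
    obtain ⟨i, rfl⟩ := hsurj x hx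
    refine ⟨a i, ha i, p i, hpath i, fun z => ⟨fun h => ⟨i, rfl, h⟩, ?_⟩⟩
    rintro ⟨j, hj, hz⟩
    rwa [← hinj hj]

theorem Linked.of_finset {G : SimpleGraph V} {A B : Set V} {Y : Finset V} (Q : V → Set V)
    (hQ : (Y : Set V).PairwiseDisjoint Q)
    (h : ∀ y ∈ Y, ∃ a ∈ A, ∃ b ∈ B, ∃ p : G.Walk a b, ∀ x ∈ p.support, x ∈ Q y) :
    G.Linked A B Y.card := by
  classical
  refine ⟨fun i => Q (Y.equivFin.symm i), ?_, fun i => ?_⟩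
  · intro i j hij
    apply hQ (Finset.coe_mem _) (Finset.coe_mem _)
    intro h
    exact hij (Y.equivFin.symm.injective (Subtype.ext h))
  · obtain ⟨a, ha, b, hb, p, hp⟩ := h _ (Y.equivFin.symm i).2
    exact ⟨a, ha, b, hb, p.bypass, p.bypass_isPath,
      fun x hx => hp x (p.support_bypass_subset_support hx)⟩

theorem Linked.mono {G G' : SimpleGraph V} (h : G' ≤ G) {A B : Set V} {k : ℕ}
    (hl : G'.Linked A B k) : G.Linked A B k := by
  obtain ⟨Q, hQ, hp⟩ := hl
  refine ⟨Q, hQ, fun i => ?_⟩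
  obtain ⟨a, ha, b, hb, p, hp, hpQ⟩ := hp i
  refine ⟨a, ha, b, hb, p.mapLe h, (Walk.isPath_mapLe h).2 hp, ?_⟩
  simpa using hpQ

/-- As `S` separates in `G'`, a path from `A` and a path from `B` can meet only in a point of `S`
that ends both. The two families are glued at the points of `S`, and the remaining two paths by the
edge `xy`. -/
theorem Linked.combine {G G' : SimpleGraph V} (hle : G' ≤ G) {A B : Set V} {S : Finset V}
    [DecidableEq V] {x y : V} (hxy : G.Adj x y) (hx : x ∉ S) (hy : y ∉ S)
    (hS : G'.Separates A B S)
    (h1 : G'.Linked A (insert x S : Finset V) (S.card + 1))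
    (h2 : G'.Linked B (insert y S : Finset V) (S.card + 1)) : G.Linked A B (S.card + 1) := by
  obtain ⟨Q, hQ, hP⟩ := h1.exists_family (Finset.card_insert_of_notMem hx)
  obtain ⟨R, hR, hP'⟩ := h2.exists_family (Finset.card_insert_of_notMem hy)
  have hQself : ∀ s ∈ insert x S, s ∈ Q s := by
    intro s hs
    obtain ⟨a, ha, p, hp, hpQ⟩ := hP s hs
    exact (hpQ s).1 p.end_mem_support
  have hRself : ∀ s ∈ insert y S, s ∈ R s := by
    intro s hs
    obtain ⟨a, ha, p, hp, hpQ⟩ := hP' s hs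
    exact (hpQ s).1 p.end_mem_support
  have hQuniq : ∀ s ∈ insert x S, ∀ t ∈ insert x S, t ∈ Q s → t = s := by
    intro s hs t ht hts
    by_contra hne
    exact Set.disjoint_left.1 (hQ ht hs hne) (hQself t ht) hts
  have hRuniq : ∀ s ∈ insert y S, ∀ t ∈ insert y S, t ∈ R s → t = s := by
    intro s hs t ht hts
    by_contra hne
    exact Set.disjoint_left.1 (hR ht hs hne) (hRself t ht) hts
  have key : ∀ s ∈ insert x S, ∀ t ∈ insert y S, ∀ w, w ∈ Q s → w ∈ R t → s = t ∧ s ∈ S := by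
    intro s hs t ht w hws hwt
    obtain ⟨a, ha, p, hp, hpQ⟩ := hP s hs
    obtain ⟨b, hb, q, hq, hqR⟩ := hP' t ht
    have hwp := (hpQ w).2 hws
    have hwq := (hqR w).2 hwt
    obtain ⟨z, hz, hzs⟩ := hS a ha b hb
      ((p.takeUntil w hwp).append (q.takeUntil w hwq).reverse)
    rcases (Walk.mem_support_append_iff _ _).1 hzs with h | h
    · have hzQ := (hpQ z).1 (p.support_takeUntil_subset_support hwp h)
      have hzeq := hQuniq s hs z (Finset.mem_insert_of_mem hz) hzQ
      subst hzeq
      have hwz : w = z := by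
        by_contra hne
        exact Walk.endpoint_notMem_support_takeUntil hp hwp (Ne.symm hne) h
      subst hwz
      exact ⟨hRuniq t ht w (Finset.mem_insert_of_mem hz) hwt, hz⟩
    · rw [Walk.support_reverse, List.mem_reverse] at h
      have hzR := (hqR z).1 (q.support_takeUntil_subset_support hwq h)
      have hzeq := hRuniq t ht z (Finset.mem_insert_of_mem hz) hzR
      subst hzeq
      have hwz : w = z := by
        by_contra hne
        exact Walk.endpoint_notMem_support_takeUntil hq hwq (Ne.symm hne) h
      subst hwz
      have := hQuniq s hs w (Finset.mem_insert_of_mem hz) hws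
      exact ⟨this.symm, this ▸ hz⟩
  set f : V → V := fun t => if t ∈ S then t else x with hf
  have hfmem : ∀ t, f t ∈ insert x S := by
    intro t
    by_cases h : t ∈ S <;> simp [hf, h]
  have hfinj : ∀ s ∈ insert y S, ∀ t ∈ insert y S, f s = f t → s = t := by
    intro s hs t ht hst
    rw [Finset.mem_insert] at hs ht
    by_cases h : s ∈ S <;> by_cases h' : t ∈ S <;> simp only [hf, h, h', if_true, if_false] at hst
    · exact hst
    · exact absurd (hst ▸ h) hx
    · exact absurd (hst ▸ h') hx
    · rw [hs.resolve_right h, ht.resolve_right h']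
  have hfS : ∀ t, f t ∈ S → f t = t := by
    intro t h
    by_cases h' : t ∈ S
    · simp [hf, h']
    · simp [hf, h', hx] at h
  rw [← Finset.card_insert_of_notMem hy]
  refine Linked.of_finset (fun t => Q (f t) ∪ R t) ?_ ?_
  · intro s hs t ht hst
    have hs' : s ∈ insert y S := hs
    have ht' : t ∈ insert y S := ht
    refine Set.disjoint_left.2 ?_
    rintro w (h | h) (h' | h')
    · exact Set.disjoint_left.1 (hQ (hfmem s) (hfmem t) fun h => hst (hfinj s hs' t ht' h)) h h'
    · obtain ⟨h1, h2⟩ := key _ (hfmem s) t ht' w h h'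
      exact hst ((hfS s h2).symm.trans h1)
    · obtain ⟨h1, h2⟩ := key _ (hfmem t) s hs' w h' h
      exact hst (((hfS t h2).symm.trans h1).symm)
    · exact Set.disjoint_left.1 (hR hs ht hst) h h'
  · intro t ht
    obtain ⟨a, ha, p, hp, hpQ⟩ := hP _ (hfmem t)
    obtain ⟨b, hb, q, hq, hqR⟩ := hP' t ht
    have hj : ∃ r : G.Walk (f t) t, ∀ z ∈ r.support, z = f t ∨ z = t := by
      by_cases h : t ∈ S
      · have : f t = t := by simp [hf, h]
        rw [this]
        exact ⟨.nil, by simp⟩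
      · have h1 : f t = x := by simp [hf, h]
        have h2 : t = y := (Finset.mem_insert.1 ht).resolve_right h
        rw [h1, h2]
        exact ⟨.cons hxy .nil, by simp⟩
    obtain ⟨r, hr⟩ := hj
    refine ⟨a, ha, b, hb, ((p.mapLe hle).append r).append (q.mapLe hle).reverse, ?_⟩
    intro z hz
    rcases (Walk.mem_support_append_iff _ _).1 hz with h | h
    · rcases (Walk.mem_support_append_iff _ _).1 h with h | h
      · exact .inl ((hpQ z).1 (by simpa using h))
      · rcases hr z h with rfl | rfl
        · exact .inl (hQself _ (hfmem _))
        · exact .inr (hRself _ ht)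
    · exact .inr ((hqR z).1 (by simpa using h))

/-- **Menger's theorem** for sets of vertices. -/
theorem linked_of_le_card_separator [Finite V] (G : SimpleGraph V) (A B : Set V) (k : ℕ)
    (h : ∀ X : Finset V, G.Separates A B X → k ≤ X.card) : G.Linked A B k := by
  classical
  have := Fintype.ofFinite V
  induction G using WellFoundedLT.induction generalizing A B with
  | ind G ih =>
  by_cases hG : G = ⊥
  · subst hG
    have hsep : (⊥ : SimpleGraph V).Separates A B (A ∩ B).toFinset := by
      intro a ha b hb p
      cases p with
      | nil => exact ⟨a, by simp [ha, hb], by simp⟩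
      | cons h _ => exact absurd h (by simp)
    obtain ⟨Y, hY, hYc⟩ := Finset.exists_subset_card_eq (h _ hsep)
    rw [← hYc]
    refine Linked.of_finset (fun y => {y}) (fun s _ t _ hst => by simpa using hst) ?_
    intro y hy
    have : y ∈ A ∩ B := by simpa using hY hy
    exact ⟨y, this.1, y, this.2, .nil, by simp⟩
  · obtain ⟨u, v, huv⟩ := ne_bot_iff_exists_adj.1 hG
    have hle : G.deleteEdges {s(u, v)} ≤ G := deleteEdges_le _
    have hlt : G.deleteEdges {s(u, v)} < G := by
      refine lt_of_le_of_ne hle fun h => ?_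
      have : (G.deleteEdges {s(u, v)}).Adj u v := h.ge huv
      simp [deleteEdges_adj] at this
    by_cases hS : ∀ X : Finset V, (G.deleteEdges {s(u, v)}).Separates A B X → k ≤ X.card
    · exact (ih _ hlt A B hS).mono hle
    push Not at hS
    obtain ⟨S, hS, hSk⟩ := hS
    have hnot : ¬ G.Separates A B S := fun hh => absurd (h S hh) (by omega)
    simp only [Separates, not_forall, not_exists, not_and] at hnot
    obtain ⟨a₀, ha₀, b₀, hb₀, p₀, hp₀⟩ := hnot
    rcases exists_reachableAvoiding_of_walk (u := u) (v := v) p₀ (fun z hz hzS => hp₀ z hzS hz)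
      with h1 | ⟨x, y, hxy, hax, hyb⟩
    · exact absurd h1 (hS.not_reachableAvoiding ha₀ hb₀)
    rw [← hxy] at hS hax hyb hlt hle
    have hadj : G.Adj x y := by rw [← mem_edgeSet, hxy]; exact huv
    have hxS : x ∉ S := by
      obtain ⟨p, hp⟩ := hax
      exact hp x p.end_mem_support
    have hyS : y ∉ S := by
      obtain ⟨p, hp⟩ := hyb
      exact hp y p.start_mem_support
    have hsep : ∀ c, (c = x ∨ c = y) → G.Separates A B (insert c S : Finset V) := by
      intro c hc a ha b hb p
      by_contra hcon
      push Not at hcon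
      have hpc : c ∉ p.support := hcon c (by simp)
      have he : ∀ e ∈ p.edges, e ∉ ({s(x, y)} : Set (Sym2 V)) := by
        rintro e he rfl
        rcases hc with rfl | rfl
        · exact hpc (p.fst_mem_support_of_mem_edges he)
        · exact hpc (p.snd_mem_support_of_mem_edges he)
      obtain ⟨z, hz, hzp⟩ := hS a ha b hb (p.toDeleteEdges _ he)
      exact hcon z (by simp only [Finset.coe_insert]; exact Set.mem_insert_of_mem _ hz)
        (by simpa [Walk.toDeleteEdges] using hzp)
    -- Adding an end of the deleted edge to `S` gives a separator of `G` itself, so `S` is only one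
    -- short of `k`.
    have hk : S.card + 1 = k := by
      have := h _ (hsep x (.inl rfl))
      rw [Finset.card_insert_of_notMem hxS] at this
      omega
    subst hk
    refine Linked.combine hle hadj hxS hyS hS (ih _ hlt _ _ ?_) (ih _ hlt _ _ ?_)
    -- `Z` also separates `A` from `B` in `G`: a walk that used the edge before meeting `insert x S`
    -- would reach `y` off `S` and could continue to `b₀`.
    · intro Z hZ
      apply h
      intro a ha b hb p
      have hmeet := hsep x (.inl rfl) a ha b hb p
      rw [Finset.coe_insert] at hmeet hZ
      rcases exists_walk_to_insert (y := y) (by exact_mod_cast hyS) p hmeet with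
        ⟨w, hw, q, hq⟩ | hr
      · obtain ⟨z, hz, hzq⟩ := hZ a ha w hw q
        exact ⟨z, hz, hq z hzq⟩
      · exact absurd (hr.trans hyb) (hS.not_reachableAvoiding ha hb₀)
    · intro Z hZ
      apply h
      refine Separates.symm ?_
      intro b hb a ha p
      have hmeet := (hsep y (.inr rfl)).symm b hb a ha p
      rw [Finset.coe_insert] at hmeet hZ
      have hcases := exists_walk_to_insert (y := x) (by exact_mod_cast hxS) p hmeet
      rw [Sym2.eq_swap] at hcases
      rcases hcases with ⟨w, hw, q, hq⟩ | hr
      · obtain ⟨z, hz, hzq⟩ := hZ b hb w hw q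
        exact ⟨z, hz, hq z hzq⟩
      · exact absurd (hax.trans hr.symm) (hS.not_reachableAvoiding ha₀ hb)

/-- Removing both ends of a path reduces the version for two vertices to the version for the two
neighbourhoods. -/
theorem exists_inner_walk {G : SimpleGraph V} {u v : V} (huv : u ≠ v) (hnadj : ¬ G.Adj u v)
    {S : Set V} (h : G.ReachableAvoiding S u v) :
    ∃ a, G.Adj u a ∧ ∃ b, G.Adj v b ∧ ∃ p : (G.deleteIncidenceSet u |>.deleteIncidenceSet v).Walk a b,
      ∀ x ∈ p.support, x ∉ S := by
  classical
  obtain ⟨p, hp⟩ := h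
  have hp' : ∀ z ∈ p.bypass.support, z ∉ S := fun z hz => hp z (p.support_bypass_subset_support hz)
  have hpath := p.bypass_isPath
  generalize p.bypass = q at hp' hpath
  cases q with
  | nil => exact absurd rfl huv
  | @cons _ a _ h q =>
    rw [Walk.cons_isPath_iff] at hpath
    obtain ⟨hq, huq⟩ := hpath
    have hq' := hq.reverse
    have huq' : u ∉ q.reverse.support := by simpa using huq
    have hS : ∀ z ∈ q.reverse.support, z ∉ S := fun z hz => hp' z (by
      simp only [Walk.support_reverse, List.mem_reverse] at hz
      simp [hz])
    generalize q.reverse = r at hq' huq' hS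
    cases r with
    | nil => exact absurd h hnadj
    | @cons _ b _ h' r =>
      rw [Walk.cons_isPath_iff] at hq'
      have hur : u ∉ r.support := fun hh => huq' (by simp [hh])
      refine ⟨a, h, b, h', (r.transfer _ ?_).reverse, ?_⟩
      · intro e he
        induction e with
        | h x y =>
          have hx := r.fst_mem_support_of_mem_edges he
          have hy := r.snd_mem_support_of_mem_edges he
          rw [mem_edgeSet, deleteIncidenceSet_adj, deleteIncidenceSet_adj]
          refine ⟨⟨r.adj_of_mem_edges he, ?_, ?_⟩, ?_, ?_⟩
          · rintro rfl; exact hur hx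
          · rintro rfl; exact hur hy
          · rintro rfl; exact hq'.2 hx
          · rintro rfl; exact hq'.2 hy
      · intro x hx
        exact hS x (by simp at hx; simp [hx])

theorem ne_of_mem_support_deleteIncidenceSet {G : SimpleGraph V} {u v : V} (hnadj : ¬ G.Adj u v)
    {a b : V} (ha : G.Adj u a)
    (p : ((G.deleteIncidenceSet u).deleteIncidenceSet v).Walk a b) {x : V} (hxp : x ∈ p.support) :
    x ≠ u ∧ x ≠ v := by
  have haway : ∀ x y, ((G.deleteIncidenceSet u).deleteIncidenceSet v).Adj x y →
      x ≠ u ∧ x ≠ v := by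
    intro x y hy
    rw [deleteIncidenceSet_adj, deleteIncidenceSet_adj] at hy
    exact ⟨hy.1.2.1, hy.2.1⟩
  by_cases hn : p.Nil
  · have hxa : x = a := by
      cases p with
      | nil => simpa using hxp
      | cons _ _ => simp at hn
    subst hxa
    refine ⟨fun h => (h ▸ ha : G.Adj u u).ne rfl, ?_⟩
    rintro rfl
    exact hnadj ha
  · obtain ⟨e, he, hxe⟩ := (Walk.mem_support_iff_exists_mem_edges_of_not_nil hn).1 hxp
    induction e with
    | h c d =>
      have := p.adj_of_mem_edges he
      rcases Sym2.mem_iff.1 hxe with rfl | rfl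
      · exact haway _ _ this
      · exact haway _ _ this.symm

/-- **Menger's theorem** for two nonadjacent vertices. -/
theorem exists_internally_disjoint_paths [Finite V] {G : SimpleGraph V} {u v : V} (huv : u ≠ v)
    (hnadj : ¬ G.Adj u v) (k : ℕ)
    (h : ∀ S : Finset V, S.card < k → u ∉ S → v ∉ S → G.ReachableAvoiding S u v) :
    ∃ P : Fin k → G.Path u v, Injective P ∧
      ∀ i j, i ≠ j → ∀ x : V, x ∈ (P i : G.Walk u v).support → x ∈ (P j : G.Walk u v).support →
        x = u ∨ x = v := by
  classical
  have hle : (G.deleteIncidenceSet u).deleteIncidenceSet v ≤ G :=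
    (deleteIncidenceSet_le _ _).trans (deleteIncidenceSet_le _ _)
  have hlink : ((G.deleteIncidenceSet u).deleteIncidenceSet v).Linked
      {a | G.Adj u a} {b | G.Adj v b} k := by
    apply linked_of_le_card_separator
    intro X hX
    by_contra hcard
    have hsub : (X.erase u).erase v ⊆ X := (Finset.erase_subset _ _).trans (Finset.erase_subset _ _)
    obtain ⟨a, ha, b, hb, p, hp⟩ := exists_inner_walk huv hnadj
      (h ((X.erase u).erase v) (by have := Finset.card_le_card hsub; omega) (by simp) (by simp))
    obtain ⟨x, hx, hxp⟩ := hX a ha b hb p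
    have hx' := ne_of_mem_support_deleteIncidenceSet hnadj ha p hxp
    apply hp x hxp
    simp only [Finset.coe_erase, Set.mem_sdiff, Set.mem_singleton_iff]
    exact ⟨⟨hx, hx'.1⟩, hx'.2⟩
  obtain ⟨Q, hQ, hq⟩ := hlink
  choose a ha b hb p hp hpQ using hq
  have havoid : ∀ i, ∀ x ∈ (p i).support, x ≠ u ∧ x ≠ v := fun i x hx =>
    ne_of_mem_support_deleteIncidenceSet hnadj (ha i) (p i) hx
  have hsupp : ∀ i, ∀ x, x ∈ (Walk.cons (ha i) (((p i).mapLe hle).concat (hb i).symm)).support →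
      x = u ∨ x = v ∨ x ∈ (p i).support := by
    intro i x hx
    simp [Walk.support_concat] at hx
    tauto
  have hpath : ∀ i, (Walk.cons (ha i) (((p i).mapLe hle).concat (hb i).symm)).IsPath := by
    intro i
    refine Walk.IsPath.cons (Walk.IsPath.concat ((Walk.isPath_mapLe hle).2 (hp i)) ?_ _) ?_
    · intro hv
      exact (havoid i v (by simpa using hv)).2 rfl
    · intro hu
      simp only [Walk.support_concat, List.mem_append, List.mem_singleton,
  Walk.support_mapLe_eq_support] at hu
      rcases hu with hu | hu
      · exact (havoid i u hu).1 rfl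
      · exact huv hu
  have hdisj : ∀ i j, i ≠ j → ∀ x ∈ (p i).support, x ∉ (p j).support := fun i j hij x hx hx' =>
    Set.disjoint_left.1 (hQ hij) (hpQ i x hx) (hpQ j x hx')
  refine ⟨fun i => ⟨_, hpath i⟩, ?_, ?_⟩
  · intro i j hij
    by_contra hne
    have h1 : a i ∈ (Walk.cons (ha j) (((p j).mapLe hle).concat (hb j).symm)).support := by
      have hval := congrArg Subtype.val hij
      simp only at hval
      rw [← hval]
      simp [Walk.support_concat]
    have h2 := havoid i (a i) (p i).start_mem_support
    rcases hsupp j _ h1 with h | h | h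
    · exact h2.1 h
    · exact h2.2 h
    · exact hdisj i j hne _ (p i).start_mem_support h
  · intro i j hij x hx hx'
    have h1 := hsupp i x hx
    have h2 := hsupp j x hx'
    have h3 := hdisj i j hij x
    tauto

end SimpleGraph

/-! ### Internally disjoint paths in k-connected graphs. -/

namespace MonoConn
open SimpleGraph Function

variable {V : Type*} [Fintype V]

theorem IsKConnected.reachableAvoiding {G : SimpleGraph V} {k : ℕ} (hG : IsKConnected G k)
    {U : Finset V} (hU : U.card < k) {u v : V} (hu : u ∉ U) (hv : v ∉ U) :
    G.ReachableAvoiding U u v := by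
  obtain ⟨p⟩ := (hG.2 U hU).preconnected ⟨u, hu⟩ ⟨v, hv⟩
  refine ⟨p.map (Embedding.induce _).toHom, ?_⟩
  intro z hz
  obtain ⟨y, -, rfl⟩ := List.mem_map.1 ((congrArg (z ∈ ·)
    (Walk.support_map (Embedding.induce {v | v ∉ U}).toHom p)).mp hz)
  exact y.2

/-- In a `k`-connected graph any two vertices are joined by `k` internally disjoint paths. -/
theorem IsKConnected.exists_paths {G : SimpleGraph V} {k : ℕ} (hG : IsKConnected G k) {u v : V}
    (huv : u ≠ v) :
    ∃ P : Fin k → G.Path u v, Injective P ∧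
      ∀ i j, i ≠ j → ∀ x : V, x ∈ (P i : G.Walk u v).support → x ∈ (P j : G.Walk u v).support →
        x = u ∨ x = v := by
  classical
  by_cases hadj : G.Adj u v
  · obtain _ | m := k
    · exact ⟨fun i => i.elim0, fun i => i.elim0, fun i => i.elim0⟩
    have hle : G.deleteEdges {s(u, v)} ≤ G := deleteEdges_le _
    have hreach : ∀ S : Finset V, S.card < m → u ∉ S → v ∉ S →
        (G.deleteEdges {s(u, v)}).ReachableAvoiding S u v := by
      intro S hS hu hv
      -- Both `u` and `v` are joined to a third vertex `w` while the other one is deleted along with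
      -- `S`, so the edge `uv` is not needed.
      obtain ⟨w, hw⟩ : ∃ w, w ∉ insert u (insert v S) := by
        by_contra hcon
        push Not at hcon
        have h1 := Finset.card_insert_le u (insert v S)
        have h2 := Finset.card_insert_le v S
        have h3 := hG.1
        rw [← Finset.card_univ, ← Finset.eq_univ_iff_forall.2 hcon] at h3
        omega
      simp only [Finset.mem_insert, not_or] at hw
      have key : ∀ c d, (c = u ∨ c = v) → c ∉ insert d S → w ∉ insert d S → (d = u ∨ d = v) →
          (G.deleteEdges {s(u, v)}).ReachableAvoiding S c w := by
        intro c d hc hcd hwd hd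
        obtain ⟨p, hp⟩ := hG.reachableAvoiding (U := insert d S)
          (by have := Finset.card_insert_le d S; omega) hcd hwd
        have he : ∀ e ∈ p.edges, e ∉ ({s(u, v)} : Set (Sym2 V)) := by
          rintro e he rfl
          rcases hd with rfl | rfl
          · exact hp _ (p.fst_mem_support_of_mem_edges he) (by simp)
          · exact hp _ (p.snd_mem_support_of_mem_edges he) (by simp)
        refine ⟨p.toDeleteEdges _ he, fun z hz => ?_⟩
        have := hp z (by simpa [Walk.toDeleteEdges] using hz)
        simp at this ⊢
        tauto
      exact (key u v (.inl rfl) (by simp [huv, hu]) (by simp [hw]) (.inr rfl)).trans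
        (key v u (.inr rfl) (by simp [huv.symm, hv]) (by simp [hw]) (.inl rfl)).symm
    obtain ⟨P, hP, hdisj⟩ := exists_internally_disjoint_paths huv
      (by simp [deleteEdges_adj]) m hreach
    refine ⟨Fin.cons (Path.singleton hadj)
      (fun i => ⟨(P i : Walk _ u v).mapLe hle, (Walk.isPath_mapLe hle).2 (P i).2⟩), ?_, ?_⟩
    · rw [Fin.cons_injective_iff]
      refine ⟨?_, ?_⟩
      · rintro ⟨i, hi⟩
        have h1 : s(u, v) ∈ ((P i : Walk _ u v).mapLe hle).edges := by
          have hval := congrArg Subtype.val hi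
          simp only at hval
          rw [hval]
          simp [Path.singleton]
        have := (P i : Walk _ u v).adj_of_mem_edges (by simpa using h1)
        simp [deleteEdges_adj] at this
      · intro i j hij
        apply hP
        apply Subtype.ext
        exact Walk.map_injective_of_injective (f := Hom.ofLE hle) injective_id u v
          (Subtype.ext_iff.1 hij)
    · have h0 : ∀ x, x ∈ (Path.singleton hadj : G.Walk u v).support → x = u ∨ x = v := by
        intro x hx
        simpa [Path.singleton] using hx
      intro i j hij x
      refine Fin.cases ?_ (fun i => ?_) i hij
      · intro _ hx _
        exact h0 x hx
      · refine Fin.cases ?_ (fun j => ?_) j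
        · intro _ _ hx
          exact h0 x hx
        · intro hij hx hx'
          exact hdisj i j (fun h => hij (h ▸ rfl)) x (by simpa using hx) (by simpa using hx')
  · exact exists_internally_disjoint_paths huv hadj k
      fun S hS hu hv => hG.reachableAvoiding hS hu hv

end MonoConn

/-! ### Systems of edge-disjoint connected graphs. -/

namespace MonoConn
open SimpleGraph Finset

variable {V ι : Type*}

/-- The degree of `v` in the graph `H i`, as an integer. -/
noncomputable def deg (H : ι → SimpleGraph V) (i : ι) (v : V) : ℤ := ((H i).neighborSet v).ncard

/-- The number of edges of the graph `H i`, as an integer. -/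
noncomputable def size (H : ι → SimpleGraph V) (i : ι) : ℤ := (H i).edgeSet.ncard

/-- A family of pairwise edge-disjoint connected graphs with at least two edges each, in which any
two distinct vertices satisfy the degree conditions imposed by `k` internally disjoint
monochromatic paths. -/
structure IsSystem [Fintype ι] (H : ι → SimpleGraph V) (k : ℤ) : Prop where
  unique : ∀ i j u v, (H i).Adj u v → (H j).Adj u v → i = j
  two_le : ∀ i, 2 ≤ size H i
  reachable : ∀ i, ∀ u ∈ (H i).support, ∀ v ∈ (H i).support, (H i).Reachable u v
  minSum : ∀ u v, u ≠ v → k - 1 ≤ ∑ i, min (deg H i u) (deg H i v)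
  minSum_adj : ∀ i u v, (H i).Adj u v → k ≤ ∑ j, min (deg H j u) (deg H j v)

section Basic
theorem deg_nonneg (H : ι → SimpleGraph V) (i : ι) (v : V) : 0 ≤ deg H i v := by simp [deg]

variable [Fintype V] (H : ι → SimpleGraph V)

theorem deg_pos_iff {i : ι} {v : V} : 0 < deg H i v ↔ ∃ w, (H i).Adj v w := by
  rw [deg, Nat.cast_pos, Set.ncard_pos]
  rfl

theorem sum_deg (i : ι) : ∑ v, deg H i v = 2 * size H i := by
  classical
  have h := (H i).sum_degrees_eq_twice_card_edges
  have h1 : ∀ v, deg H i v = ((H i).degree v : ℤ) := by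
    intro v
    rw [deg, Set.ncard_eq_toFinset_card', ← card_neighborSet_eq_degree, Set.toFinset_card]
  have h2 : size H i = ((H i).edgeFinset.card : ℤ) := by
    rw [size, Set.ncard_eq_toFinset_card']
    rfl
  rw [Finset.sum_congr rfl fun v _ => h1 v, h2]
  exact_mod_cast h

open Classical in
/-- The vertices that are incident with an edge of `H i`. -/
noncomputable def supp (i : ι) : Finset V := univ.filter fun v => 0 < deg H i v

theorem mem_supp {i : ι} {v : V} : v ∈ supp H i ↔ 0 < deg H i v := by simp [supp]

theorem adj_supp {i : ι} {u v : V} (h : (H i).Adj u v) : v ∈ supp H i :=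
  (mem_supp H).2 ((deg_pos_iff H).2 ⟨u, h.symm⟩)

theorem sum_pos_eq_card_supp (i : ι) [∀ v, Decidable (0 < deg H i v)] :
    ∑ v, (if 0 < deg H i v then (1 : ℤ) else 0) = (supp H i).card := by
  rw [supp, Finset.sum_boole]
  norm_cast

variable [Fintype ι]

open Classical in
/-- The neighbours of `v` in the union of the family. -/
noncomputable def nbrs (v : V) : Finset V := univ.filter fun w => ∃ i, (H i).Adj v w

theorem mem_nbrs {v w : V} : w ∈ nbrs H v ↔ ∃ i, (H i).Adj v w := by simp [nbrs]

variable {H} {k : ℤ} (hH : IsSystem H k)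
include hH

theorem IsSystem.card_nbrs (v : V) : ((nbrs H v).card : ℤ) = ∑ i, deg H i v := by
  classical
  have h : nbrs H v = univ.biUnion fun i => ((H i).neighborSet v).toFinset := by
    ext w; simp [mem_nbrs]
  rw [h, Finset.card_biUnion]
  · push_cast
    refine Finset.sum_congr rfl fun i _ => ?_
    rw [deg, Set.ncard_eq_toFinset_card']
  · intro i _ j _ hij
    rw [Function.onFun, Finset.disjoint_left]
    intro w hw hw'
    simp only [Set.mem_toFinset, mem_neighborSet] at hw hw'
    exact hij (hH.unique i j v w hw hw')

theorem IsSystem.induce_connected (i : ι) : ((H i).induce (H i).support).Connected := by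
  have hne : (H i).support.Nonempty := by
    rw [Set.nonempty_iff_ne_empty]
    intro h
    have h2 := hH.two_le i
    have : (H i).edgeSet = ∅ := by
      rw [Set.eq_empty_iff_forall_notMem]
      intro e he
      induction e with
      | h x y =>
        have : x ∈ (H i).support := (H i).mem_support.2 ⟨y, he⟩
        rw [h] at this
        exact this
    rw [size, this] at h2
    simp at h2
  have := hne.to_subtype
  refine ⟨?_⟩
  rintro ⟨u, hu⟩ ⟨v, hv⟩
  obtain ⟨p⟩ := hH.reachable i u hu v hv
  refine ⟨p.induce _ ?_⟩
  intro x hx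
  by_cases hn : p.Nil
  · cases p with
    | nil => simp at hx; exact hx ▸ hu
    | cons _ _ => simp at hn
  · obtain ⟨e, he, hxe⟩ := (Walk.mem_support_iff_exists_mem_edges_of_not_nil hn).1 hx
    induction e with
    | h c d =>
      have := p.adj_of_mem_edges he
      rcases Sym2.mem_iff.1 hxe with rfl | rfl
      · exact this.mem_support_left
      · exact this.mem_support_right

theorem IsSystem.card_supp_le (i : ι) : ((supp H i).card : ℤ) ≤ size H i + 1 := by
  classical
  have h := (hH.induce_connected i).card_vert_le_card_edgeSet_add_one
  have h1 : Nat.card (H i).support = (supp H i).card := by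
    rw [Nat.card_coe_set_eq, ← Set.ncard_coe_finset]
    congr 1
    ext v
    simp [mem_supp, deg_pos_iff, mem_support]
  have h2 : Nat.card ((H i).induce (H i).support).edgeSet ≤ (H i).edgeSet.ncard := by
    rw [← Nat.card_coe_set_eq]
    exact Nat.card_le_card_of_injective _ (Embedding.induce (H i).support).mapEdgeSet.injective
  rw [h1] at h
  rw [size]
  omega

/-- Such an edge would be a whole component, but members are connected with at least two edges. -/
theorem IsSystem.not_adj_of_deg_eq_one {i : ι} {u v : V} (huv : (H i).Adj u v)
    (hu : deg H i u = 1) (hv : deg H i v = 1) : False := by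
  have hu' : (H i).neighborSet u = {v} := by
    obtain ⟨x, hx⟩ := Set.ncard_eq_one.1 (by rw [deg] at hu; exact_mod_cast hu : ((H i).neighborSet u).ncard = 1)
    have : v ∈ (H i).neighborSet u := huv
    rw [hx] at this ⊢
    rw [Set.mem_singleton_iff.1 this]
  have hv' : (H i).neighborSet v = {u} := by
    obtain ⟨x, hx⟩ := Set.ncard_eq_one.1 (by rw [deg] at hv; exact_mod_cast hv : ((H i).neighborSet v).ncard = 1)
    have : u ∈ (H i).neighborSet v := huv.symm
    rw [hx] at this ⊢
    rw [Set.mem_singleton_iff.1 this]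
  have hclosed : ∀ x, (H i).Reachable u x → x = u ∨ x = v := by
    rintro x ⟨p⟩
    suffices h : ∀ a b (p : (H i).Walk a b), (a = u ∨ a = v) → (b = u ∨ b = v) from
      h _ _ p (.inl rfl)
    intro a b p
    induction p with
    | nil => exact id
    | @cons a c b h p ih =>
      intro ha
      apply ih
      rcases ha with rfl | rfl
      · have : c ∈ (H i).neighborSet a := h
        rw [hu'] at this; exact .inr this
      · have : c ∈ (H i).neighborSet a := h
        rw [hv'] at this; exact .inl this
  have h2 := hH.two_le i
  have hsub : (H i).edgeSet ⊆ {s(u, v)} := by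
    intro e he
    induction e with
    | h x y =>
      have hxy : (H i).Adj x y := he
      have hx := hclosed x (hH.reachable i u huv.mem_support_left x hxy.mem_support_left)
      have hy := hclosed y (hH.reachable i u huv.mem_support_left y hxy.mem_support_right)
      have := hxy.ne
      rcases hx with rfl | rfl <;> rcases hy with rfl | rfl <;> simp_all [Sym2.eq_swap]
  have := Set.ncard_le_ncard hsub
  rw [Set.ncard_singleton] at this
  rw [size] at h2
  omega

theorem IsSystem.three_le_card_supp (i : ι) : (3 : ℤ) ≤ (supp H i).card := by
  by_contra hcon
  obtain ⟨e, he⟩ : ((H i).edgeSet).Nonempty := by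
    rw [Set.nonempty_iff_ne_empty]
    intro h
    have := hH.two_le i
    rw [size, h] at this
    simp at this
  induction e with
  | h u v =>
    have huv : (H i).Adj u v := he
    have hle : ∀ x, deg H i x ≤ (supp H i).card - 1 := by
      classical
      intro x
      by_cases hx : x ∈ supp H i
      · have : (H i).neighborSet x ⊆ (supp H i).erase x := by
          intro y hy
          have hy' : (H i).Adj x y := hy
          simp [hy'.ne', adj_supp H hy']
        have := Set.ncard_le_ncard this
        rw [Set.ncard_coe_finset, Finset.card_erase_of_mem hx] at this
        have := Finset.card_pos.2 ⟨x, hx⟩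
        rw [deg]
        omega
      · have h0 := deg_nonneg H i x
        have := Finset.card_pos.2 ⟨v, adj_supp H huv⟩
        rw [mem_supp] at hx
        omega
    have h1 := (mem_supp H).1 (adj_supp H huv)
    have h2 := (mem_supp H).1 (adj_supp H huv.symm)
    have h3 := hle u
    have h4 := hle v
    exact hH.not_adj_of_deg_eq_one huv (by omega) (by omega)

end Basic

end MonoConn

/-! ### Counting edges as seen from one vertex. -/

namespace MonoConn
open SimpleGraph Finset

variable {V ι : Type*} [Fintype V] [Fintype ι] (H : ι → SimpleGraph V)

/-- The total degree of `v`. -/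
noncomputable def tot (v : V) : ℤ := ∑ i, deg H i v

open Classical in
/-- The members of the family that have an edge at `v`. -/
noncomputable def cols (v : V) : Finset ι := univ.filter fun i => 0 < deg H i v

open Classical in
/-- The members of the family that have no edge at `v`. -/
noncomputable def outer (v : V) : Finset ι := univ.filter fun i => ¬ 0 < deg H i v

/-- The degree of `w` in those members of the family that have an edge at `v`. -/
noncomputable def degIn (v w : V) : ℤ := ∑ i ∈ cols H v, deg H i w

/-- The degree of `w` in those members of the family that have no edge at `v`. -/
noncomputable def degOut (v w : V) : ℤ := ∑ i ∈ outer H v, deg H i w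

/-- The sum over the family of the smaller of the two degrees. -/
noncomputable def minDeg (v w : V) : ℤ := ∑ i, min (deg H i v) (deg H i w)

theorem mem_cols {i : ι} {v : V} : i ∈ cols H v ↔ 0 < deg H i v := by simp [cols]

theorem mem_outer {i : ι} {v : V} : i ∈ outer H v ↔ ¬ 0 < deg H i v := by simp [outer]

theorem sum_cols_add_sum_outer (v : V) (f : ι → ℤ) :
    ∑ i ∈ cols H v, f i + ∑ i ∈ outer H v, f i = ∑ i, f i := by
  classical
  exact Finset.sum_filter_add_sum_filter_not _ _ _

theorem degIn_add_degOut (v w : V) : degIn H v w + degOut H v w = tot H w :=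
  sum_cols_add_sum_outer H v _

theorem degOut_nonneg (v w : V) : 0 ≤ degOut H v w :=
  Finset.sum_nonneg fun i _ => deg_nonneg H i w

theorem degOut_self (v : V) : degOut H v v = 0 := by
  refine Finset.sum_eq_zero fun i hi => ?_
  have := deg_nonneg H i v
  rw [mem_outer] at hi
  omega

theorem degIn_self (v : V) : degIn H v v = tot H v := by
  rw [← degIn_add_degOut H v v, degOut_self, add_zero]

theorem minDeg_self (v : V) : minDeg H v v = tot H v := by simp [minDeg, tot]

theorem minDeg_eq_sum_cols (v w : V) :
    minDeg H v w = ∑ i ∈ cols H v, min (deg H i v) (deg H i w) := by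
  rw [minDeg, ← sum_cols_add_sum_outer H v, Finset.sum_eq_zero (s := outer H v), add_zero]
  intro i hi
  rw [mem_outer] at hi
  have := deg_nonneg H i v
  have := deg_nonneg H i w
  omega

theorem card_cols_le (v : V) : ((cols H v).card : ℤ) ≤ tot H v := by
  rw [← degIn_self, degIn, Finset.cast_card]
  refine Finset.sum_le_sum fun i hi => ?_
  rw [mem_cols] at hi
  omega

theorem sum_degIn (v : V) : ∑ w, degIn H v w = ∑ i ∈ cols H v, 2 * size H i := by
  simp only [degIn]
  rw [Finset.sum_comm]
  exact Finset.sum_congr rfl fun i _ => sum_deg H i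

theorem sum_degOut (v : V) : ∑ w, degOut H v w = ∑ i ∈ outer H v, 2 * size H i := by
  simp only [degOut]
  rw [Finset.sum_comm]
  exact Finset.sum_congr rfl fun i _ => sum_deg H i

/-- Twice the number of edges, minus twice the number of graphs. -/
noncomputable def waste : ℤ := ∑ i, (2 * size H i - 2)

theorem waste_eq (v : V) :
    waste H = ∑ w, degIn H v w - 2 * (cols H v).card + ∑ i ∈ outer H v, (2 * size H i - 2) := by
  rw [waste, ← sum_cols_add_sum_outer H v, sum_degIn, Finset.sum_sub_distrib]
  simp [mul_comm]

/-- The members of the family in which `v` has degree one. -/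
noncomputable def leaves (v : V) : Finset ι := by
  classical exact univ.filter fun i => deg H i v = 1

theorem mem_leaves {i : ι} {v : V} : i ∈ leaves H v ↔ deg H i v = 1 := by simp [leaves]

theorem leaves_subset_cols (v : V) : leaves H v ⊆ cols H v := by
  intro i hi
  rw [mem_leaves] at hi
  rw [mem_cols]
  omega

theorem two_mul_card_cols_le (v : V) :
    2 * ((cols H v).card : ℤ) ≤ tot H v + (leaves H v).card := by
  classical
  rw [← degIn_self, degIn, Finset.cast_card, Finset.mul_sum,
    ← Finset.sum_sdiff (leaves_subset_cols H v), ← Finset.sum_sdiff (leaves_subset_cols H v),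
    Finset.cast_card, add_assoc, ← Finset.sum_add_distrib]
  refine add_le_add (Finset.sum_le_sum fun i hi => ?_) (Finset.sum_le_sum fun i hi => ?_)
  · rw [Finset.mem_sdiff, mem_leaves, mem_cols] at hi
    omega
  · rw [mem_leaves] at hi
    omega

-- In a member where `v` is a leaf the minimum is at most 1, so all but one of the edges at `w` are
-- surplus.
open Classical in
theorem minDeg_add_sum_le_degIn {v : V} {L : Finset ι} (hL : L ⊆ leaves H v) (w : V) :
    minDeg H v w + ∑ i ∈ L, (deg H i w - if 0 < deg H i w then 1 else 0) ≤ degIn H v w := by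
  rw [minDeg_eq_sum_cols, degIn, ← Finset.sum_sdiff (hL.trans (leaves_subset_cols H v)),
    ← Finset.sum_sdiff (hL.trans (leaves_subset_cols H v)), add_assoc, ← Finset.sum_add_distrib]
  refine add_le_add (Finset.sum_le_sum fun i hi => min_le_right _ _)
    (Finset.sum_le_sum fun i hi => ?_)
  have h1 := (mem_leaves H).1 (hL hi)
  have := deg_nonneg H i w
  split_ifs <;> omega

-- The edge of `v` in a leaf member that misses `w` contributes nothing to the minimum.
open Classical in
theorem minDeg_add_sum_le_tot {v : V} {L : Finset ι} (hL : L ⊆ leaves H v) (w : V) :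
    minDeg H v w + ∑ i ∈ L, (1 - if 0 < deg H i w then 1 else 0) ≤ tot H v := by
  rw [minDeg_eq_sum_cols, ← degIn_self, degIn,
    ← Finset.sum_sdiff (hL.trans (leaves_subset_cols H v)),
    ← Finset.sum_sdiff (hL.trans (leaves_subset_cols H v)), add_assoc, ← Finset.sum_add_distrib]
  refine add_le_add (Finset.sum_le_sum fun i hi => min_le_left _ _)
    (Finset.sum_le_sum fun i hi => ?_)
  have h1 := (mem_leaves H).1 (hL hi)
  have := deg_nonneg H i w
  split_ifs <;> omega

theorem minDeg_le_tot (v w : V) : minDeg H v w ≤ tot H v :=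
  Finset.sum_le_sum fun _ _ => min_le_left _ _

theorem minDeg_le_degIn (v w : V) : minDeg H v w ≤ degIn H v w := by
  rw [minDeg_eq_sum_cols]
  exact Finset.sum_le_sum fun _ _ => min_le_right _ _

theorem notMem_nbrs_self (v : V) : v ∉ nbrs H v := by simp [mem_nbrs]

variable {H} {k : ℤ} (hH : IsSystem H k)
include hH

theorem IsSystem.le_minDeg {v w : V} (h : v ≠ w) : k - 1 ≤ minDeg H v w := hH.minSum v w h

theorem IsSystem.le_minDeg_of_mem_nbrs {v w : V} (h : w ∈ nbrs H v) : k ≤ minDeg H v w := by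
  obtain ⟨i, hi⟩ := (mem_nbrs H).1 h
  exact hH.minSum_adj i v w hi

theorem IsSystem.card_nbrs_eq_tot (v : V) : ((nbrs H v).card : ℤ) = tot H v := hH.card_nbrs v

theorem IsSystem.le_tot [Nontrivial V] (hk : 2 ≤ k) (v : V) : k ≤ tot H v := by
  obtain ⟨w, hw⟩ := exists_ne v
  have h1 := hH.le_minDeg hw.symm
  have h2 : 0 < tot H v := by
    have := minDeg_le_tot H v w
    omega
  rw [← hH.card_nbrs_eq_tot, Nat.cast_pos, Finset.card_pos] at h2
  obtain ⟨x, hx⟩ := h2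
  exact (hH.le_minDeg_of_mem_nbrs hx).trans (minDeg_le_tot H v x)

theorem IsSystem.le_degIn [Nontrivial V] (hk : 2 ≤ k) (v w : V) : k - 1 ≤ degIn H v w := by
  by_cases h : v = w
  · subst h
    rw [degIn_self]
    have := hH.le_tot hk v
    omega
  · exact (hH.le_minDeg h).trans (minDeg_le_degIn H v w)

/-- The members at `v` supply at most k - 1 of the k needed for adjacent vertices, so a member
missing `v` contains both. -/
theorem IsSystem.exists_outer_of_mem_nbrs {v w x : V} (hw : degIn H v w ≤ k - 1)
    (hx : x ∈ nbrs H w) : ∃ j ∈ outer H v, 0 < deg H j w ∧ 0 < deg H j x := by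
  have h1 := hH.le_minDeg_of_mem_nbrs hx
  rw [minDeg, ← sum_cols_add_sum_outer H v] at h1
  have h2 : ∑ i ∈ cols H v, min (deg H i w) (deg H i x) ≤ degIn H v w :=
    Finset.sum_le_sum fun _ _ => min_le_left _ _
  obtain ⟨j, hj, hj'⟩ := Finset.exists_lt_of_sum_lt (s := outer H v) (f := fun _ => (0 : ℤ))
    (g := fun i => min (deg H i w) (deg H i x)) (by simp; omega)
  exact ⟨j, hj, by omega⟩

/-- Discharging: each member missing `v` hands out at most twice its term of the sum, and each
vertex of `B` receives at least 2. -/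
theorem IsSystem.card_bad_le_sum_outer [Nontrivial V] (hk : 2 ≤ k) (v : V) (B : Finset V)
    (hB : ∀ w ∈ B, degIn H v w = k - 1) :
    (B.card : ℤ) ≤ ∑ j ∈ outer H v, (2 * size H j - 2) := by
  classical
  -- A member gives 2 to each of its vertices in `B` if it can afford this, and otherwise the
  -- degree, which costs at most 2e ≤ 4e - 4.
  set f : ι → V → ℤ := fun j w =>
    if 0 < deg H j w then
      if ((supp H j ∩ B).card : ℤ) ≤ 2 * size H j - 2 then 2 else deg H j w
    else 0 with hf
  have h1 : ∀ j, ∑ w ∈ B, f j w ≤ 2 * (2 * size H j - 2) := by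
    intro j
    by_cases hj : ((supp H j ∩ B).card : ℤ) ≤ 2 * size H j - 2
    · have : ∑ w ∈ B, f j w = 2 * (supp H j ∩ B).card := by
        simp only [hf, hj, if_true]
        rw [← Finset.sum_filter, Finset.sum_const]
        have : B.filter (fun w => 0 < deg H j w) = supp H j ∩ B := by
          ext w; simp [mem_supp, and_comm]
        rw [this]
        simp [mul_comm]
      omega
    · have h2 : ∑ w ∈ B, f j w ≤ ∑ w, deg H j w := by
        calc ∑ w ∈ B, f j w ≤ ∑ w ∈ B, deg H j w := by
              refine Finset.sum_le_sum fun w _ => ?_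
              have := deg_nonneg H j w
              simp only [hf, hj, if_false]
              split_ifs <;> omega
          _ ≤ _ := Finset.sum_le_sum_of_subset_of_nonneg (Finset.subset_univ _)
              fun w _ _ => deg_nonneg H j w
      rw [sum_deg] at h2
      have := hH.two_le j
      omega
  have hf0 : ∀ j w, 0 ≤ f j w := by
    intro j w
    have := deg_nonneg H j w
    simp only [hf]
    split_ifs <;> omega
  have h2 : ∀ w ∈ B, 2 ≤ ∑ j ∈ outer H v, f j w := by
    intro w hw
    by_cases hgood : ∃ j ∈ outer H v, 0 < deg H j w ∧
        ((supp H j ∩ B).card : ℤ) ≤ 2 * size H j - 2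
    · obtain ⟨j, hj, hjw, hjc⟩ := hgood
      have : f j w = 2 := by simp [hf, hjw, hjc]
      rw [← this]
      exact Finset.single_le_sum (f := fun j => f j w) (fun j _ => hf0 j w) hj
    push Not at hgood
    have hsum : ∑ j ∈ outer H v, f j w = degOut H v w := by
      refine Finset.sum_congr rfl fun j hj => ?_
      have := deg_nonneg H j w
      by_cases hjw : 0 < deg H j w
      · simp only [hf, hjw, if_true]
        rw [if_neg (not_le.2 (hgood j hj hjw))]
      · simp only [hf, hjw, if_false]
        omega
    rw [hsum]
    have htot := hH.le_tot hk w
    rw [← degIn_add_degOut H v w, hB w hw] at htot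
    by_contra hlt
    have hout : degOut H v w = 1 := by omega
    obtain ⟨j, hj, hj1⟩ : ∃ j ∈ outer H v, 0 < deg H j w := by
      have := Finset.exists_lt_of_sum_lt (s := outer H v) (f := fun _ => (0 : ℤ))
        (g := fun i => deg H i w) (by simp only [sum_const_zero]; change 0 < degOut H v w; omega)
      exact this
    have huniq : ∀ i ∈ outer H v, 0 < deg H i w → i = j := by
      intro i hi hi1
      by_contra hne
      have : deg H i w + deg H j w ≤ degOut H v w := by
        rw [← Finset.sum_pair (f := fun i => deg H i w) hne]
        refine Finset.sum_le_sum_of_subset_of_nonneg ?_ fun i _ _ => deg_nonneg H i w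
        intro l hl
        simp only [Finset.mem_insert, Finset.mem_singleton] at hl
        rcases hl with rfl | rfl <;> assumption
      omega
    -- The only outer member at `w` cannot afford 2 per vertex, so it is a path with two edges
    -- inside `B`. It contains all neighbours of `w`, which forces k = 2; an edge at `w` in a member
    -- meeting `v` then has both ends of degree one.
    have hjbad := hgood j hj hj1
    have hle := hH.card_supp_le j
    have h3 := hH.three_le_card_supp j
    have hsub := Finset.card_le_card (Finset.inter_subset_left (s₁ := supp H j) (s₂ := B))
    have h2le := hH.two_le j
    have hsubB : supp H j ⊆ B := by
      rw [← Finset.inter_eq_left]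
      exact Finset.eq_of_subset_of_card_le Finset.inter_subset_left (by omega)
    have hnb : ∀ x ∈ nbrs H w, x ∈ supp H j := by
      intro x hx
      obtain ⟨i, hi, hiw, hix⟩ := hH.exists_outer_of_mem_nbrs (hB w hw).le hx
      rw [huniq i hi hiw] at hix
      exact (mem_supp H).2 hix
    have hcard : (nbrs H w).card + 1 ≤ (supp H j).card := by
      rw [← Finset.card_insert_of_notMem (notMem_nbrs_self H w)]
      refine Finset.card_le_card ?_
      intro x hx
      rcases Finset.mem_insert.1 hx with rfl | hx
      · exact (mem_supp H).2 hj1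
      · exact hnb x hx
    have h4 := hH.card_nbrs_eq_tot w
    rw [← degIn_add_degOut H v w, hB w hw, hout] at h4
    have hk2 : k = 2 := by omega
    obtain ⟨i, hi, hiw⟩ : ∃ i ∈ cols H v, 0 < deg H i w := by
      have := Finset.exists_lt_of_sum_lt (s := cols H v) (f := fun _ => (0 : ℤ))
        (g := fun i => deg H i w)
        (by simp only [sum_const_zero]; change 0 < degIn H v w; rw [hB w hw]; omega)
      exact this
    obtain ⟨x, hx⟩ := (deg_pos_iff H).1 hiw
    have hxB : x ∈ B := hsubB (hnb x ((mem_nbrs H).2 ⟨i, hx⟩))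
    have hle1 : ∀ y ∈ B, deg H i y ≤ 1 := by
      intro y hy
      have := Finset.single_le_sum (f := fun i => deg H i y) (fun i _ => deg_nonneg H i y) hi
      have h5 := hB y hy
      rw [degIn] at h5
      omega
    have hx1 := (mem_supp H).1 (adj_supp H hx)
    exact hH.not_adj_of_deg_eq_one hx (by have := hle1 w hw; omega) (by have := hle1 x hxB; omega)
  have h3 : ∑ w ∈ B, (2 : ℤ) ≤ ∑ j ∈ outer H v, 2 * (2 * size H j - 2) :=
    calc ∑ w ∈ B, (2 : ℤ) ≤ ∑ w ∈ B, ∑ j ∈ outer H v, f j w := Finset.sum_le_sum h2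
      _ = ∑ j ∈ outer H v, ∑ w ∈ B, f j w := Finset.sum_comm
      _ ≤ _ := Finset.sum_le_sum fun j _ => h1 j
  rw [← Finset.mul_sum, Finset.sum_const, nsmul_eq_mul] at h3
  omega

/-- Summing `degIn` gives k per vertex plus the excess, minus 1 for each vertex with value k - 1;
the outer members repay these losses. -/
theorem IsSystem.le_waste [Nontrivial V] (hk : 2 ≤ k) (v : V) :
    k * Fintype.card V - 2 * (cols H v).card + ∑ w, max 0 (degIn H v w - k) ≤ waste H := by
  classical
  have h1 := hH.card_bad_le_sum_outer hk v (univ.filter fun w => degIn H v w = k - 1)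
    (by simp)
  rw [waste_eq H v]
  have h2 : k * Fintype.card V + ∑ w, max 0 (degIn H v w - k) ≤
      ∑ w, degIn H v w + (univ.filter fun w => degIn H v w = k - 1).card := by
    rw [← Finset.card_univ, mul_comm, ← nsmul_eq_mul, ← Finset.sum_const, Finset.cast_card,
      Finset.sum_filter, ← Finset.sum_add_distrib, ← Finset.sum_add_distrib]
    refine Finset.sum_le_sum fun w _ => ?_
    have := hH.le_degIn hk v w
    split_ifs <;> omega
  omega

end MonoConn

/-! ### Vertices of total degree k. -/

namespace MonoConn
open SimpleGraph Finset

variable {V ι : Type*} [Fintype V] [Fintype ι] {H : ι → SimpleGraph V} {k : ℤ}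
  (hH : IsSystem H k)
include hH

theorem IsSystem.le_waste_of_card_cols_le_one [Nontrivial V] (hk : 2 ≤ k) {v : V}
    (hv : (cols H v).card ≤ 1) : k * Fintype.card V - 2 ≤ waste H := by
  have h1 := hH.le_waste hk v
  have h2 : 0 ≤ ∑ w, max 0 (degIn H v w - k) := Finset.sum_nonneg fun w _ => le_max_left _ _
  omega

open Classical in
theorem IsSystem.card_deficient_add_le {v : V} (hv : tot H v = k) :
    ((univ.filter fun w => minDeg H v w ≤ k - 1).card : ℤ) + 1 + k ≤ Fintype.card V := by
  have h1 := hH.card_nbrs_eq_tot v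
  rw [hv] at h1
  have h2 : (univ.filter fun w => minDeg H v w ≤ k - 1).card + (insert v (nbrs H v)).card ≤
      Fintype.card V := by
    rw [← Finset.card_univ, ← Finset.card_union_of_disjoint]
    · exact Finset.card_le_card (Finset.subset_univ _)
    · rw [Finset.disjoint_left]
      intro w hw hw'
      rw [Finset.mem_filter] at hw
      rcases Finset.mem_insert.1 hw' with rfl | h
      · have := minDeg_self H w
        omega
      · have := hH.le_minDeg_of_mem_nbrs h
        omega
  rw [Finset.card_insert_of_notMem (notMem_nbrs_self H v)] at h2
  omega

theorem IsSystem.card_supp_sub_two_le (i : ι) [∀ w, Decidable (0 < deg H i w)] :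
    ((supp H i).card : ℤ) - 2 ≤ ∑ w, (deg H i w - if 0 < deg H i w then 1 else 0) := by
  rw [Finset.sum_sub_distrib, sum_deg, sum_pos_eq_card_supp]
  have := hH.card_supp_le i
  omega

/-- Connectedness gives a surplus of at least s - 2 in member `i`, where s is the size of its
support. The n - s vertices off the support are all deficient (`minDeg` below k), and at most n - k
- 1 vertices are deficient. So at most s - k - 1 of the surplus is lost on deficient vertices of the
support. -/
theorem IsSystem.le_sum_of_leaf [Nontrivial V] {v : V} (hv : tot H v = k) {i : ι}
    (hi : deg H i v = 1) : k - 1 ≤ ∑ w, max 0 (degIn H v w - k) := by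
  classical
  have hL : {i} ⊆ leaves H v := by simpa [mem_leaves] using hi
  have h1 := hH.card_supp_sub_two_le i
  have h2 := hH.card_deficient_add_le hv
  rw [← sum_pos_eq_card_supp] at h1
  rw [← Finset.card_univ, Finset.cast_card (univ : Finset V), Finset.cast_card,
    Finset.sum_filter] at h2
  have h3 : ∑ w, (deg H i w - if 0 < deg H i w then 1 else 0) + ∑ w, (if 0 < deg H i w then 1 else 0)
      + ∑ _w : V, (1 : ℤ) ≤
      ∑ w, max 0 (degIn H v w - k) + ∑ w, (if minDeg H v w ≤ k - 1 then 1 else 0) +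
      2 * ∑ w, (if 0 < deg H i w then 1 else 0) := by
    rw [Finset.mul_sum, ← Finset.sum_add_distrib, ← Finset.sum_add_distrib,
      ← Finset.sum_add_distrib, ← Finset.sum_add_distrib]
    refine Finset.sum_le_sum fun w _ => ?_
    have h4 := minDeg_add_sum_le_degIn H hL w
    have h5 := minDeg_add_sum_le_tot H hL w
    have h6 := deg_nonneg H i w
    rw [Finset.sum_singleton] at h4 h5
    rw [hv] at h5
    have h7 : k - 1 ≤ minDeg H v w := by
      by_cases h : v = w
      · rw [← h, minDeg_self, hv]; omega
      · exact hH.le_minDeg h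
    split_ifs at h4 h5 ⊢ <;> omega
  omega

/-- A vertex misses at most one of the two members, and only if it is deficient. With D deficient
vertices the supports have total size at least 2n - D, so the excess is at least 2n - 2D - 4, where
D ≤ n - k - 1. -/
theorem IsSystem.le_sum_of_two_leaves [Nontrivial V] {v : V} (hv : tot H v = k) {i j : ι}
    (hij : i ≠ j) (hi : deg H i v = 1) (hj : deg H j v = 1) :
    2 * k - 2 ≤ ∑ w, max 0 (degIn H v w - k) := by
  classical
  have hL : {i, j} ⊆ leaves H v := by
    intro l hl
    simp only [Finset.mem_insert, Finset.mem_singleton] at hl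
    rw [mem_leaves]
    rcases hl with rfl | rfl <;> assumption
  have h1 := hH.card_supp_sub_two_le i
  have h1' := hH.card_supp_sub_two_le j
  have h2 := hH.card_deficient_add_le hv
  rw [← sum_pos_eq_card_supp] at h1 h1'
  rw [← Finset.card_univ, Finset.cast_card (univ : Finset V), Finset.cast_card,
    Finset.sum_filter] at h2
  have h3 : ∑ w, (deg H i w - if 0 < deg H i w then 1 else 0) +
      ∑ w, (deg H j w - if 0 < deg H j w then 1 else 0) ≤
      ∑ w, max 0 (degIn H v w - k) + ∑ w, (if minDeg H v w ≤ k - 1 then 1 else 0) := by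
    rw [← Finset.sum_add_distrib, ← Finset.sum_add_distrib]
    refine Finset.sum_le_sum fun w _ => ?_
    have h4 := minDeg_add_sum_le_degIn H hL w
    have h7 : k - 1 ≤ minDeg H v w := by
      by_cases h : v = w
      · rw [← h, minDeg_self, hv]; omega
      · exact hH.le_minDeg h
    have h6 := deg_nonneg H i w
    have h6' := deg_nonneg H j w
    rw [Finset.sum_pair hij] at h4
    split_ifs at h4 ⊢ <;> omega
  have h3' : 2 * ∑ _w : V, (1 : ℤ) ≤ ∑ w, (if 0 < deg H i w then 1 else 0) +
      ∑ w, (if 0 < deg H j w then 1 else 0) + ∑ w, (if minDeg H v w ≤ k - 1 then 1 else 0) := by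
    rw [Finset.mul_sum, ← Finset.sum_add_distrib, ← Finset.sum_add_distrib]
    refine Finset.sum_le_sum fun w _ => ?_
    have h5 := minDeg_add_sum_le_tot H hL w
    have h7 : k - 1 ≤ minDeg H v w := by
      by_cases h : v = w
      · rw [← h, minDeg_self, hv]; omega
      · exact hH.le_minDeg h
    rw [Finset.sum_pair hij] at h5
    rw [hv] at h5
    split_ifs at h5 ⊢ <;> omega
  omega

/-- With two leaf members the excess 2k - 2 matches c(v) ≤ k; with one, the excess k - 1 matches
2c(v) ≤ k + 1. -/
theorem IsSystem.le_waste_of_leaf [Nontrivial V] (hk : 2 ≤ k) {v : V} (hv : tot H v = k) {i : ι}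
    (hi : deg H i v = 1) : k * Fintype.card V - 2 ≤ waste H := by
  classical
  have h1 := hH.le_waste hk v
  by_cases h : ∃ j, i ≠ j ∧ deg H j v = 1
  · obtain ⟨j, hij, hj⟩ := h
    have h2 := hH.le_sum_of_two_leaves hv hij hi hj
    have h3 := card_cols_le H v
    omega
  · push Not at h
    have h2 := hH.le_sum_of_leaf hv hi
    have h3 := two_mul_card_cols_le H v
    have h4 : (leaves H v).card ≤ 1 := by
      rw [Finset.card_le_one]
      intro a ha b hb
      rw [mem_leaves] at ha hb
      have ha' : i = a := by by_contra hne; exact h a hne ha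
      have hb' : i = b := by by_contra hne; exact h b hne hb
      rw [← ha', ← hb']
    omega

theorem IsSystem.two_mul_waste_eq (v : V) :
    ∑ w, tot H w + ∑ w, degIn H v w - 4 * (cols H v).card +
      2 * ∑ j ∈ outer H v, (size H j - 2) = 2 * waste H := by
  have h1 : ∑ w, tot H w = ∑ w, degIn H v w + ∑ w, degOut H v w := by
    rw [← Finset.sum_add_distrib]
    exact Finset.sum_congr rfl fun w _ => (degIn_add_degOut H v w).symm
  have h2 : 2 * ∑ j ∈ outer H v, (2 * size H j - 2) =
      ∑ j ∈ outer H v, 2 * size H j + 2 * ∑ j ∈ outer H v, (size H j - 2) := by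
    rw [Finset.mul_sum, Finset.mul_sum, ← Finset.sum_add_distrib]
    exact Finset.sum_congr rfl fun _ _ => by ring
  rw [h1, sum_degOut]
  have := waste_eq H v
  omega

/-- Each leaf member adds its support, up to a loss of 2, to the sum of `minDeg`. A neighbour of `v`
lies in all but at most `tot H v - k` leaf members, which gives the bonus `m`. -/
theorem IsSystem.le_sum_degIn (v : V) (Y : ℤ) (hY : ∀ w, w ≠ v → w ∉ nbrs H v → Y ≤ minDeg H v w)
    (m : ℤ) (hm : m = 0 ∨ m + tot H v ≤ k + (leaves H v).card) :
    tot H v - (leaves H v).card + tot H v * (k + m) +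
      (Fintype.card V - 1 - tot H v) * Y ≤ ∑ w, degIn H v w := by
  classical
  set L := leaves H v with hL
  set g : V → ℤ := fun w => minDeg H v w + ∑ i ∈ L, (if 0 < deg H i w then (1 : ℤ) else 0) with hg
  have h1 : ∑ w, g w - 2 * L.card ≤ ∑ w, degIn H v w := by
    have h2 : ∑ w, (minDeg H v w + ∑ i ∈ L, (deg H i w - if 0 < deg H i w then 1 else 0)) ≤
        ∑ w, degIn H v w :=
      Finset.sum_le_sum fun w _ => minDeg_add_sum_le_degIn H (Finset.Subset.refl _) w
    rw [Finset.sum_add_distrib, Finset.sum_comm (s := univ)] at h2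
    rw [hg, Finset.sum_add_distrib, Finset.sum_comm (s := univ)]
    have h3 : ∑ i ∈ L, ∑ w, (if 0 < deg H i w then (1 : ℤ) else 0) - 2 * L.card ≤
        ∑ i ∈ L, ∑ w, (deg H i w - if 0 < deg H i w then 1 else 0) := by
      rw [mul_comm, ← nsmul_eq_mul, ← Finset.sum_const, ← Finset.sum_sub_distrib]
      refine Finset.sum_le_sum fun i _ => ?_
      have := hH.card_supp_sub_two_le i
      rwa [← sum_pos_eq_card_supp] at this
    omega
  have hLw : ∀ w, 0 ≤ ∑ i ∈ L, (if 0 < deg H i w then (1 : ℤ) else 0) := fun w =>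
    Finset.sum_nonneg fun i _ => by split_ifs <;> simp
  have hgv : g v = tot H v + L.card := by
    rw [hg]
    simp only [minDeg_self]
    rw [Finset.cast_card]
    congr 1
    refine Finset.sum_congr rfl fun i hi => ?_
    rw [hL, mem_leaves] at hi
    simp [hi]
  have hgn : ∀ w ∈ nbrs H v, k + m ≤ g w := by
    intro w hw
    have h2 := hH.le_minDeg_of_mem_nbrs hw
    have h3 := hLw w
    have h4 := minDeg_add_sum_le_tot H (L := L) (Finset.Subset.refl _) w
    rw [Finset.sum_sub_distrib, ← Finset.cast_card] at h4
    simp only [hg]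
    omega
  have hgr : ∀ w ∈ (univ \ insert v (nbrs H v)), Y ≤ g w := by
    intro w hw
    simp only [Finset.mem_sdiff, Finset.mem_univ, Finset.mem_insert, not_or, true_and] at hw
    have := hY w hw.1 hw.2
    have := hLw w
    simp only [hg]
    omega
  have hsum : ∑ w, g w = ∑ w ∈ univ \ insert v (nbrs H v), g w + (g v + ∑ w ∈ nbrs H v, g w) := by
    rw [← Finset.sum_insert (notMem_nbrs_self H v), Finset.sum_sdiff (Finset.subset_univ _)]
  have hs1 := Finset.card_nsmul_le_sum _ _ _ hgn
  have hs2 := Finset.card_nsmul_le_sum _ _ _ hgr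
  have hc : ((univ \ insert v (nbrs H v)).card : ℤ) = Fintype.card V - 1 - tot H v := by
    have := Finset.card_sdiff_add_card_eq_card (Finset.subset_univ (insert v (nbrs H v)))
    rw [Finset.card_insert_of_notMem (notMem_nbrs_self H v), Finset.card_univ] at this
    have h := hH.card_nbrs_eq_tot v
    omega
  rw [nsmul_eq_mul, hH.card_nbrs_eq_tot] at hs1
  rw [nsmul_eq_mul, hc] at hs2
  linarith

end MonoConn

/-! ### The structure of a too small system. -/

namespace MonoConn
open SimpleGraph Finset

variable {V ι : Type*} [Fintype V] [Fintype ι] {H : ι → SimpleGraph V} {k : ℤ}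

/-- The arithmetic of the averaging argument: `D` is the minimum total degree, `l` and `c` count the
leaf members and all members at a minimum vertex, and `W` is the waste. -/
theorem two_mul_le_of_no_tight {k n D l c m W : ℤ} (hk : 2 ≤ k) (hk5 : k ≤ 5) (hD : k + 1 ≤ D)
    (hn : D + 1 ≤ n) (hc : c ≤ D) (hc2 : 2 * c ≤ D + l)
    (hm0 : 0 ≤ m) (hm : l ≤ D - k + m)
    (hW : D * n + (D - l + D * (k + m) + (n - 1 - D) * (k - 1)) - 4 * c ≤ 2 * W) :
    2 * k * n - 5 ≤ 2 * W ∨ k = 4 ∧ 2 * k * n - 6 ≤ 2 * W := by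
  have h1 : (D + 1) * (D - k - 1) ≤ n * (D - k - 1) := by
    apply mul_le_mul_of_nonneg_right hn; omega
  have h2 : D * (D - k + 2) + D * m - 2 * k - l - 4 * c ≤ 2 * W - 2 * k * n := by
    nlinarith
  obtain ⟨a, rfl⟩ : ∃ a, D = k + a := ⟨D - k, by ring⟩
  by_cases ha : a = 1
  · subst ha
    -- The delicate case D = k + 1, where k ≤ 5 matters: l = 1 and c = 3 give the errors 5 for k = 5
    -- and 6 for k = 4.
    interval_cases k <;> omega
  have ha2 : 2 ≤ a := by omega
  left
  by_cases hla : l ≤ a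
  · nlinarith
  · nlinarith

variable (hH : IsSystem H k)
include hH

/-- Otherwise a vertex of minimum total degree D ≥ k + 1 is used to average the sums of `tot` and
`degIn`. -/
theorem IsSystem.exists_tight [Nontrivial V] (hk : 2 ≤ k) (hk5 : k ≤ 5)
    (hW : waste H < k * Fintype.card V - 2) : ∃ v, tot H v = k := by
  by_contra hcon
  push Not at hcon
  obtain ⟨v, -, hv⟩ := Finset.exists_min_image univ (tot H) Finset.univ_nonempty
  have hvk := hH.le_tot hk v
  have hvk' := hcon v
  have h1 := hH.two_mul_waste_eq v
  have h2 := hH.le_sum_degIn v (k - 1) (fun w hw _ => hH.le_minDeg hw.symm)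
    (max 0 ((leaves H v).card - (tot H v - k))) (by omega)
  have h3 : tot H v * Fintype.card V ≤ ∑ w, tot H w := by
    rw [← Finset.card_univ, mul_comm, ← nsmul_eq_mul, ← Finset.sum_const]
    exact Finset.sum_le_sum fun w hw => hv w hw
  have h4 : 0 ≤ ∑ j ∈ outer H v, (size H j - 2) :=
    Finset.sum_nonneg fun j _ => by have := hH.two_le j; omega
  have h5 : tot H v + 1 ≤ Fintype.card V := by
    rw [← hH.card_nbrs_eq_tot, ← Finset.card_univ]
    norm_cast
    classical
    rw [← Finset.card_insert_of_notMem (notMem_nbrs_self H v)]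
    exact Finset.card_le_card (Finset.subset_univ _)
  -- Twice the waste is divisible by 4, which absorbs the errors 5 and, for k = 4, 6.
  have hW2 : ∃ x, waste H = 2 * x :=
    ⟨∑ i, (size H i - 1), by
      rw [waste, Finset.mul_sum]; exact Finset.sum_congr rfl fun _ _ => by ring⟩
  obtain ⟨x, hx⟩ := hW2
  have h6 := two_mul_le_of_no_tight (l := (leaves H v).card) (c := (cols H v).card)
    (W := waste H) hk hk5 (by omega) h5 (card_cols_le H v) (two_mul_card_cols_le H v)
    (le_max_left 0 ((leaves H v).card - (tot H v - k))) (by omega) (by linarith)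
  rw [mul_assoc] at h6
  rcases h6 with h6 | ⟨rfl, h6⟩ <;> omega

/-- All neighbours of `w` lie in outer members at `w`, and such a member with e edges offers at most
e ≤ 2 deg + (e - 2) of them. -/
theorem IsSystem.le_degOut_add_of_degIn_eq [Nontrivial V] {v w : V}
    (hw : degIn H v w = k - 1) :
    k - 1 ≤ degOut H v w + ∑ j ∈ outer H v, (size H j - 2) := by
  classical
  have hsub : nbrs H w ⊆ ((outer H v).filter fun j => 0 < deg H j w).biUnion
      fun j => (supp H j).erase w := by
    intro x hx
    obtain ⟨j, hj, hjw, hjx⟩ := hH.exists_outer_of_mem_nbrs hw.le hx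
    rw [Finset.mem_biUnion]
    refine ⟨j, by simp [hj, hjw], Finset.mem_erase.2 ⟨?_, (mem_supp H).2 hjx⟩⟩
    rintro rfl
    exact notMem_nbrs_self H _ hx
  have h1 := (Finset.card_le_card hsub).trans Finset.card_biUnion_le
  have h2 := hH.card_nbrs_eq_tot w
  rw [← degIn_add_degOut H v w, hw] at h2
  have h3 : ((∑ j ∈ (outer H v).filter fun j => 0 < deg H j w, ((supp H j).erase w).card : ℕ) : ℤ) ≤
      ∑ j ∈ outer H v, (2 * deg H j w + (size H j - 2)) := by
    push_cast
    rw [Finset.sum_filter]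
    refine Finset.sum_le_sum fun j _ => ?_
    have h4 := hH.two_le j
    have h5 := hH.card_supp_le j
    have h6 := deg_nonneg H j w
    split_ifs with h
    · have := Finset.card_erase_add_one ((mem_supp H).2 h)
      omega
    · omega
  rw [Finset.sum_add_distrib, ← Finset.mul_sum] at h3
  change _ ≤ 2 * degOut H v w + _ at h3
  omega

/-- A system that is too small has exactly two members, and every vertex but one has degree at
least two in both of them. -/
theorem IsSystem.exists_structure [Nontrivial V] (hk : 2 ≤ k) (hk5 : k ≤ 5)
    (hW : waste H < k * Fintype.card V - 2) :
    ∃ (p q : ι) (z : V), p ≠ q ∧ (∀ i, i = p ∨ i = q) ∧ 0 < deg H p z ∧ 0 < deg H q z ∧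
      ∀ w, w ≠ z → tot H w = k ∧ 2 ≤ deg H p w ∧ 2 ≤ deg H q w := by
  classical
  obtain ⟨v, hv⟩ := hH.exists_tight hk hk5 hW
  have hcols : ∀ w, 2 ≤ (cols H w).card := by
    intro w
    by_contra hcon
    have := hH.le_waste_of_card_cols_le_one hk (v := w) (by omega)
    omega
  have hleaf : ∀ w, tot H w = k → ∀ i, deg H i w ≠ 1 := by
    intro w hw i hi
    have := hH.le_waste_of_leaf hk hw hi
    omega
  have hleaves : ∀ w, tot H w = k → (leaves H w).card = 0 := by
    intro w hw
    rw [Finset.card_eq_zero, Finset.eq_empty_iff_forall_notMem]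
    intro i hi
    exact hleaf w hw i ((mem_leaves H).1 hi)
  have hc2 : (cols H v).card = 2 := by
    have h1 := two_mul_card_cols_le H v
    have h2 := hleaves v hv
    have h3 := hcols v
    omega
  have hk4 : 4 ≤ k := by
    have h1 := two_mul_card_cols_le H v
    have h2 := hleaves v hv
    omega
  set σ := ∑ j ∈ outer H v, (size H j - 2) with hσ
  have hσ0 : 0 ≤ σ := Finset.sum_nonneg fun j _ => by have := hH.two_le j; omega
  -- The surplus of `tot + degIn` over 2k. It is nonnegative, and the assumed bound with c(v) = 2
  -- leaves a total of at most 2, or 0 for k = 4 by parity.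
  set τ : V → ℤ := fun w => 2 * degIn H v w + degOut H v w - 2 * k with hτ
  have hout2 : ∀ w, degIn H v w = k - 1 → 2 ≤ degOut H v w := by
    intro w hw
    by_contra hcon
    have h1 := hH.le_tot hk w
    have h2 := degIn_add_degOut H v w
    have h3 : degOut H v w = 1 := by omega
    have h4 : tot H w = k := by omega
    obtain ⟨j, hj, hj'⟩ := Finset.exists_lt_of_sum_lt (s := outer H v) (f := fun _ => (0 : ℤ))
      (g := fun i => deg H i w) (by rw [Finset.sum_const_zero]; change 0 < degOut H v w; omega)
    have h5 : deg H j w ≤ degOut H v w :=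
      Finset.single_le_sum (f := fun i => deg H i w) (fun i _ => deg_nonneg H i w) hj
    exact hleaf w h4 j (by omega)
  have hτ0 : ∀ w, 0 ≤ τ w := by
    intro w
    have h1 := hH.le_degIn hk v w
    have h2 := degOut_nonneg H v w
    have h3 := hout2 w
    simp only [hτ]
    by_cases h : degIn H v w = k - 1
    · have := h3 h; omega
    · omega
  have hsum : ∑ w, τ w + 2 * σ ≤ 2 ∧ (k = 4 → ∑ w, τ w + 2 * σ ≤ 0) := by
    have h1 := hH.two_mul_waste_eq v
    have h2 : ∑ w, τ w = ∑ w, tot H w + ∑ w, degIn H v w - 2 * (k * Fintype.card V) := by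
      have : ∀ w, τ w = tot H w + degIn H v w - 2 * k := by
        intro w
        have := degIn_add_degOut H v w
        simp only [hτ]
        omega
      rw [Finset.sum_congr rfl fun w _ => this w, Finset.sum_sub_distrib, Finset.sum_add_distrib,
        Finset.sum_const, Finset.card_univ, nsmul_eq_mul]
      ring
    obtain ⟨x, hx⟩ : ∃ x, waste H = 2 * x :=
      ⟨∑ i, (size H i - 1), by
        rw [waste, Finset.mul_sum]; exact Finset.sum_congr rfl fun _ _ => by ring⟩
    rw [← hσ, hc2] at h1
    refine ⟨by push_cast at h1; omega, ?_⟩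
    rintro rfl
    push_cast at h1
    omega
  have hτle : ∀ w, τ w ≤ ∑ w, τ w := fun w =>
    Finset.single_le_sum (fun w _ => hτ0 w) (Finset.mem_univ w)
  have hτpair : ∀ w x, w ≠ x → τ w + τ x ≤ ∑ w, τ w := by
    intro w x hwx
    rw [← Finset.sum_pair hwx]
    exact Finset.sum_le_sum_of_subset_of_nonneg (Finset.subset_univ _) fun w _ _ => hτ0 w
  -- A vertex with `degIn` k - 1 would need surplus at least k - 3 - σ, which together with 2σ uses
  -- up everything when k = 5 and is too much when k = 4. An outer neighbour then has further
  -- surplus.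
  have hB : ∀ w, k ≤ degIn H v w := by
    intro w
    by_contra hcon
    have hw : degIn H v w = k - 1 := by have := hH.le_degIn hk v w; omega
    have h1 := hH.le_degOut_add_of_degIn_eq hw
    have h2 := hτle w
    have h3 : τ w = degOut H v w - 2 := by simp only [hτ]; omega
    have hk5' : k = 5 := by omega
    have hout : degOut H v w = 4 := by omega
    obtain ⟨j, hj, hj'⟩ := Finset.exists_lt_of_sum_lt (s := outer H v) (f := fun _ => (0 : ℤ))
      (g := fun i => deg H i w) (by rw [Finset.sum_const_zero]; change 0 < degOut H v w; omega)
    obtain ⟨b, hb⟩ := (deg_pos_iff H).1 hj'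
    have h4 : deg H j b ≤ degOut H v b :=
      Finset.single_le_sum (f := fun i => deg H i b) (fun i _ => deg_nonneg H i b) hj
    have h5 := (mem_supp H).1 (adj_supp H hb)
    have h6 := hτpair w b hb.ne
    have h7 := hH.le_degIn hk v b
    have h8 : 1 ≤ τ b := by
      by_cases h : degIn H v b = k - 1
      · have := hH.le_degOut_add_of_degIn_eq h
        simp only [hτ]; omega
      · simp only [hτ]; omega
    omega
  -- An outer member has at least three vertices, each of surplus at least 1, but only 2 is
  -- available.
  have hno : outer H v = ∅ := by
    rw [Finset.eq_empty_iff_forall_notMem]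
    intro j hj
    have h1 := hH.three_le_card_supp j
    have h2 : ((supp H j).card : ℤ) ≤ ∑ w, τ w := by
      rw [Finset.cast_card]
      refine (Finset.sum_le_sum fun w hw => ?_).trans
        (Finset.sum_le_sum_of_subset_of_nonneg (Finset.subset_univ _) fun w _ _ => hτ0 w)
      have h3 : deg H j w ≤ degOut H v w :=
        Finset.single_le_sum (f := fun i => deg H i w) (fun i _ => deg_nonneg H i w) hj
      have h4 := hB w
      rw [mem_supp] at hw
      simp only [hτ]; omega
    omega
  obtain ⟨p, q, hpq, hcpq⟩ := Finset.card_eq_two.1 hc2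
  have hall : ∀ i, i = p ∨ i = q := by
    intro i
    by_cases hi : 0 < deg H i v
    · have : i ∈ cols H v := (mem_cols H).2 hi
      rw [hcpq] at this
      simpa using this
    · have : i ∈ outer H v := (mem_outer H).2 hi
      rw [hno] at this
      simp at this
  have hpos : ∀ w i, 0 < deg H i w := by
    intro w i
    have h1 : cols H w ⊆ {p, q} := fun j _ => by simpa using hall j
    have h2 := Finset.eq_of_subset_of_card_le h1 (by rw [Finset.card_pair hpq]; exact hcols w)
    rw [← mem_cols, h2]
    simpa using hall i
  have htot : ∀ w, τ w = 2 * (tot H w - k) := by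
    intro w
    have h1 := degIn_add_degOut H v w
    have h2 : degOut H v w = 0 := by rw [degOut, hno, Finset.sum_empty]
    simp only [hτ]; omega
  -- A total degree above k costs surplus at least 2, so this happens at most once.
  obtain ⟨z, hz⟩ : ∃ z, ∀ w, w ≠ z → tot H w = k := by
    by_cases h : ∃ z, tot H z ≠ k
    · obtain ⟨z, hz⟩ := h
      refine ⟨z, fun w hw => ?_⟩
      have h1 := hτpair w z hw
      have h2 := hH.le_tot hk w
      have h3 := hH.le_tot hk z
      have h4 := htot w
      have h5 := htot z
      omega
    · push Not at h
      exact ⟨v, fun w _ => h w⟩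
  refine ⟨p, q, z, hpq, hall, hpos z p, hpos z q, fun w hw => ⟨hz w hw, ?_, ?_⟩⟩
  · have := hpos w p
    have := hleaf w (hz w hw) p
    omega
  · have := hpos w q
    have := hleaf w (hz w hw) q
    omega

end MonoConn

/-! ### Path systems, and the exclusion of the exceptional structure. -/

namespace MonoConn
open SimpleGraph Finset

variable {V K : Type*} {G : SimpleGraph V}

/-- The paths `P i` are different, internally disjoint, and `P i` runs in the graph `F (c i)`. -/
structure IsPathFamily (F : K → SimpleGraph V) {k : ℕ} {u v : V} (P : Fin k → G.Path u v)
    (c : Fin k → K) : Prop where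
  injective : Function.Injective P
  adj : ∀ i x y, s(x, y) ∈ (P i : G.Walk u v).edges → (F (c i)).Adj x y
  disjoint : ∀ i j, i ≠ j → ∀ x : V, x ∈ (P i : G.Walk u v).support →
    x ∈ (P j : G.Walk u v).support → x = u ∨ x = v

/-- The family is edge-disjoint, and any two distinct vertices are joined by `k` internally
disjoint paths, each of which runs in one member of the family. -/
structure IsPathSystem (G : SimpleGraph V) (F : K → SimpleGraph V) (k : ℕ) : Prop where
  unique : ∀ i j u v, (F i).Adj u v → (F j).Adj u v → i = j
  exists_family : ∀ u v, u ≠ v → ∃ (P : Fin k → G.Path u v) (c : Fin k → K), IsPathFamily F P c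

namespace IsPathFamily

variable {F : K → SimpleGraph V} {k : ℕ} {u v : V} {P : Fin k → G.Path u v} {c : Fin k → K}
  (hP : IsPathFamily F P c)
include hP

theorem reverse : IsPathFamily F (fun i => (P i).reverse) c where
  injective := by
    intro i j hij
    apply hP.injective
    have := congrArg (fun p : G.Path v u => (p : G.Walk v u).reverse) hij
    simp only [Path.reverse_coe, Walk.reverse_reverse] at this
    exact Subtype.ext this
  adj i x y h := hP.adj i x y (by simpa using h)
  disjoint i j hij x hx hx' := (hP.disjoint i j hij x (by simpa using hx) (by simpa using hx')).symm

theorem not_nil (huv : u ≠ v) (i : Fin k) : ¬ (P i : G.Walk u v).Nil :=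
  fun h => huv h.eq

theorem adj_snd (huv : u ≠ v) (i : Fin k) : (F (c i)).Adj u (P i : G.Walk u v).snd :=
  hP.adj i _ _ (Walk.mk_start_snd_mem_edges (hP.not_nil huv i))

theorem eq_of_mem_edges {i j : Fin k} (hi : s(u, v) ∈ (P i : G.Walk u v).edges)
    (hj : s(u, v) ∈ (P j : G.Walk u v).edges) : i = j := by
  apply hP.injective
  apply Subtype.ext
  rw [(P i).2.eq_adj_toWalk_of_mem_edges hi, (P j).2.eq_adj_toWalk_of_mem_edges hj]

/-- A shared second vertex must be `v`, and then both paths are the single edge `uv`. -/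
theorem snd_injective (huv : u ≠ v) :
    Function.Injective fun i => (P i : G.Walk u v).snd := by
  intro i j hij
  by_contra hne
  simp only at hij
  have hi := Walk.mk_start_snd_mem_edges (hP.not_nil huv i)
  have hj := Walk.mk_start_snd_mem_edges (hP.not_nil huv j)
  have h1 := (P i : G.Walk u v).snd_mem_support_of_mem_edges hi
  have h2 := (P j : G.Walk u v).snd_mem_support_of_mem_edges hj
  rw [← hij] at h2 hj
  rcases hP.disjoint i j hne _ h1 h2 with h | h
  · exact (hP.adj_snd huv i).ne h.symm
  · rw [h] at hi hj
    exact hne (hP.eq_of_mem_edges hi hj)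

theorem mk_mem_edges_of_size_le [Fintype V] (huv : u ≠ v) {i : Fin k} (hi : size F (c i) < 2) :
    s(u, v) ∈ (P i : G.Walk u v).edges := by
  have hadj := hP.adj i
  have hpath := (P i).2
  generalize (P i : G.Walk u v) = p at hadj hpath
  cases p with
  | nil => exact absurd rfl huv
  | @cons _ a _ h q =>
    cases q with
    | nil => simp
    | @cons _ b _ h' q =>
      exfalso
      have h1 := hadj u a (by simp)
      have h2 := hadj a b (by simp)
      have hub : u ≠ b := by
        rintro rfl
        simp [Walk.cons_isPath_iff] at hpath
      have hsub : ({s(u, a), s(a, b)} : Set (Sym2 V)) ⊆ (F (c i)).edgeSet := by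
        rintro e (rfl | rfl)
        · exact h1
        · exact h2
      have h3 := Set.ncard_le_ncard hsub
      rw [Set.ncard_pair (by
        intro h
        rcases Sym2.eq_iff.1 h with ⟨h, -⟩ | ⟨h, -⟩
        · exact h1.ne h
        · exact hub h)] at h3
      rw [size] at hi
      omega

end IsPathFamily

theorem exists_two_neighbors_of_mem_support {u v w : V} {p : G.Walk u v} (hp : p.IsPath)
    (hw : w ∈ p.support) (hwu : w ≠ u) (hwv : w ≠ v) :
    ∃ a b, a ≠ b ∧ s(w, a) ∈ p.edges ∧ s(w, b) ∈ p.edges := by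
  obtain ⟨n, rfl, hn⟩ := Walk.mem_support_iff_exists_getVert.1 hw
  have hn0 : n ≠ 0 := by rintro rfl; simp at hwu
  have hnl : n ≠ p.length := by rintro rfl; simp at hwv
  refine ⟨p.getVert (n - 1), p.getVert (n + 1), ?_, ?_, ?_⟩
  · intro h
    have := hp.getVert_injOn (by simp; omega) (by simp; omega) h
    omega
  · rw [Walk.mk_mem_edges_iff_exists]
    refine ⟨n - 1, by omega, ?_⟩
    rw [Nat.sub_add_cancel (by omega), Sym2.eq_swap]
  · rw [Walk.mk_mem_edges_iff_exists]
    exact ⟨n, by omega, rfl⟩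

section System

variable [Fintype V] [Fintype K] {F : K → SimpleGraph V} {k : ℕ}

/-- The members of the family that have at least two edges. -/
def large (F : K → SimpleGraph V) : {i : K // 2 ≤ size F i} → SimpleGraph V := fun i => F i

open Classical in
theorem IsPathFamily.card_le_deg {u v : V} {P : Fin k → G.Path u v} {c : Fin k → K}
    (hP : IsPathFamily F P c) (huv : u ≠ v) (i : K) :
    ((univ.filter fun a => c a = i).card : ℤ) ≤ deg F i u := by
  rw [deg, Nat.cast_le, ← Set.ncard_coe_finset]
  refine Set.ncard_le_ncard_of_injOn (fun a => (P a : G.Walk u v).snd) ?_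
    (hP.snd_injective huv).injOn
  intro a ha
  have ha' : c a = i := by simpa using ha
  rw [← ha']
  exact hP.adj_snd huv a

/-- Paths within one member use different edges at both ends, so they number at most the smaller
degree. At most one path runs in a one-edge member, and none does if `uv` lies in a large member. -/
theorem IsPathSystem.isSystem (hF : IsPathSystem G F k)
    (hconn : ∀ i, ∀ u ∈ (F i).support, ∀ v ∈ (F i).support, (F i).Reachable u v) :
    IsSystem (large F) (k : ℤ) := by
  classical
  have key : ∀ u v, u ≠ v → ∀ m : ℤ, (∀ (P : Fin k → G.Path u v) (c : Fin k → K),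
      IsPathFamily F P c → ((univ.filter fun a => size F (c a) < 2).card : ℤ) ≤ m) →
      (k : ℤ) - m ≤ ∑ i, min (deg (large F) i u) (deg (large F) i v) := by
    intro u v huv m hm
    obtain ⟨P, c, hP⟩ := hF.exists_family u v huv
    have h1 := hm P c hP
    have h2 : ∑ i : {i : K // 2 ≤ size F i}, ((univ.filter fun a => c a = i).card : ℤ) ≤
        ∑ i, min (deg (large F) i u) (deg (large F) i v) :=
      Finset.sum_le_sum fun i _ => le_min (hP.card_le_deg huv i) (hP.reverse.card_le_deg huv.symm i)
    have h3 : (univ.filter fun a => ¬ size F (c a) < 2).card =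
        ∑ i : {i : K // 2 ≤ size F i}, (univ.filter fun a => c a = i).card := by
      rw [← Finset.card_biUnion]
      · congr 1
        ext a
        simp only [not_lt, Finset.mem_filter, Finset.mem_univ, true_and, Finset.mem_biUnion,
          Subtype.exists, exists_prop, exists_eq_right']
      · intro i _ j _ hij
        rw [Function.onFun, Finset.disjoint_left]
        intro a ha ha'
        simp only [Finset.mem_filter, Finset.mem_univ, true_and] at ha ha'
        exact hij (Subtype.ext (ha.symm.trans ha'))
    have h4 := Finset.card_filter_add_card_filter_not (s := (univ : Finset (Fin k)))
      (fun a => size F (c a) < 2)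
    rw [Finset.card_univ, Fintype.card_fin] at h4
    have h5 : ((univ.filter fun a => ¬ size F (c a) < 2).card : ℤ) =
        ∑ i : {i : K // 2 ≤ size F i}, ((univ.filter fun a => c a = i).card : ℤ) := by
      exact_mod_cast h3
    omega
  refine ⟨fun i j u v h h' => Subtype.ext (hF.unique _ _ u v h h'), fun i => i.2,
    fun i => hconn i, ?_, ?_⟩
  · intro u v huv
    refine key u v huv 1 fun P c hP => ?_
    norm_cast
    rw [Finset.card_le_one]
    intro a ha b hb
    simp only [Finset.mem_filter, Finset.mem_univ, true_and] at ha hb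
    exact hP.eq_of_mem_edges (hP.mk_mem_edges_of_size_le huv ha)
      (hP.mk_mem_edges_of_size_le huv hb)
  · intro i u v huv
    have := key u v huv.ne 0 fun P c hP => ?_
    · simpa using this
    norm_cast
    rw [Nat.le_zero, Finset.card_eq_zero, Finset.filter_eq_empty_iff]
    intro a _ ha
    have h1 := hP.adj a u v (hP.mk_mem_edges_of_size_le huv.ne ha)
    have h2 := hF.unique _ _ u v h1 huv
    have := i.2
    rw [h2] at ha
    omega

/-- The k distinct second vertices exhaust the k neighbours of `u`. -/
theorem IsPathFamily.exists_snd_eq {u v : V} {P : Fin k → G.Path u v} {c : Fin k → K}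
    (hP : IsPathFamily F P c) (huv : u ≠ v) (hH : IsSystem (large F) (k : ℤ))
    (hu : tot (large F) u = k) (hnt : ∀ a, 2 ≤ size F (c a)) {y : V}
    (hy : y ∈ nbrs (large F) u) : ∃ a, (P a : G.Walk u v).snd = y := by
  classical
  have himg : univ.image (fun a => (P a : G.Walk u v).snd) = nbrs (large F) u := by
    apply Finset.eq_of_subset_of_card_le
    · intro x hx
      obtain ⟨a, -, rfl⟩ := Finset.mem_image.1 hx
      exact (mem_nbrs _).2 ⟨⟨c a, hnt a⟩, hP.adj_snd huv a⟩
    · rw [Finset.card_image_of_injective _ (hP.snd_injective huv), Finset.card_univ,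
        Fintype.card_fin]
      have := hH.card_nbrs_eq_tot u
      omega
  rw [← himg] at hy
  simpa using hy

/-- Take a p-edge `zv` and a q-edge `vx`. The paths from `v` to `x` use every large-member edge at
both ends, so `z` lies on a p-path and hence on no q-path. The vertices of the q-paths are closed
under q-adjacency, by degree two at inner vertices, so the connected member `q` would miss `z`. -/
theorem IsPathSystem.false_of_degree_two (hF : IsPathSystem G F k)
    (hH : IsSystem (large F) (k : ℤ)) {p q : {i : K // 2 ≤ size F i}} {z : V} (hpq : p ≠ q)
    (hp : 0 < deg (large F) p z) (hq : 0 < deg (large F) q z)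
    (h : ∀ w, w ≠ z → tot (large F) w = k ∧ deg (large F) q w = 2) : False := by
  classical
  obtain ⟨v, hv⟩ := (deg_pos_iff _).1 hp
  have hvz : v ≠ z := hv.ne'
  obtain ⟨x, hx⟩ := (deg_pos_iff (large F)).1 (by rw [(h v hvz).2]; norm_num :
    0 < deg (large F) q v)
  have hxz : x ≠ z := by
    rintro rfl
    exact hpq (hH.unique p q _ _ hv.symm hx)
  obtain ⟨P, c, hP⟩ := hF.exists_family v x hx.ne
  have hnt : ∀ a, 2 ≤ size F (c a) := by
    intro a
    by_contra hcon
    have h1 := hP.adj a v x (hP.mk_mem_edges_of_size_le hx.ne (by omega))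
    rw [hF.unique _ _ _ _ h1 hx] at hcon
    exact hcon q.2
  have hfirst : ∀ {u w : V} {P : Fin k → G.Path u w}, IsPathFamily F P c → u ≠ w → u ≠ z →
      ∀ i y, (large F i).Adj u y → ∃ a, c a = i ∧ y ∈ (P a : G.Walk u w).support := by
    intro u w P hP huw huz i y hy
    obtain ⟨a, rfl⟩ := hP.exists_snd_eq huw hH (h u huz).1 hnt ((mem_nbrs _).2 ⟨i, hy⟩)
    exact ⟨a, hF.unique _ _ _ _ (hP.adj_snd huw a) hy, (P a : G.Walk u w).snd_mem_support_of_mem_edges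
      (Walk.mk_start_snd_mem_edges (hP.not_nil huw a))⟩
  obtain ⟨a₀, ha₀, hza₀⟩ := hfirst hP hx.ne hvz p z hv.symm
  have hzU : ∀ a, c a = q → z ∉ (P a : G.Walk v x).support := by
    intro a ha hza
    have hne : a ≠ a₀ := by
      rintro rfl
      exact hpq (Subtype.ext (ha₀.symm.trans ha))
    rcases hP.disjoint a a₀ hne z hza hza₀ with h | h
    · exact hvz h.symm
    · exact hxz h.symm
  have hclosed : ∀ w w', (large F q).Adj w w' →
      (∃ a, c a = q ∧ w ∈ (P a : G.Walk v x).support) →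
      ∃ a, c a = q ∧ w' ∈ (P a : G.Walk v x).support := by
    rintro w w' hww' ⟨a, ha, hwa⟩
    by_cases hwv : w = v
    · subst hwv
      exact hfirst hP hx.ne hvz q w' hww'
    by_cases hwx : w = x
    · subst hwx
      obtain ⟨b, hb, hb'⟩ := hfirst hP.reverse hx.ne' hxz q w' hww'
      exact ⟨b, hb, by simpa using hb'⟩
    have hwz : w ≠ z := by
      rintro rfl
      exact hzU a ha hwa
    obtain ⟨y, y', hne, hy, hy'⟩ := exists_two_neighbors_of_mem_support (P a).2 hwa hwv hwx
    refine ⟨a, ha, ?_⟩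
    have h1 : (large F q).Adj w y := by
      have := hP.adj a _ _ hy; rwa [ha] at this
    have h2 : (large F q).Adj w y' := by
      have := hP.adj a _ _ hy'; rwa [ha] at this
    have h3 : (({y, y'} : Set V)) = (large F q).neighborSet w := by
      refine Set.eq_of_subset_of_ncard_le ?_ ?_
      · rintro b (rfl | rfl)
        · exact h1
        · exact h2
      · have := (h w hwz).2
        rw [deg] at this
        rw [Set.ncard_pair hne]
        omega
    have h4 : w' ∈ ({y, y'} : Set V) := by rw [h3]; exact hww'
    rcases h4 with rfl | rfl
    · exact (P a : G.Walk v x).snd_mem_support_of_mem_edges hy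
    · exact (P a : G.Walk v x).snd_mem_support_of_mem_edges hy'
  have hreach : ∀ a b, (large F q).Reachable a b →
      (∃ i, c i = q ∧ a ∈ (P i : G.Walk v x).support) →
      ∃ i, c i = q ∧ b ∈ (P i : G.Walk v x).support := by
    rintro a b ⟨r⟩
    induction r with
    | nil => exact id
    | cons hadj _ ih => exact fun ha => ih (hclosed _ _ hadj ha)
  obtain ⟨a, ha, -⟩ := hfirst hP hx.ne hvz q x hx
  obtain ⟨y, hy⟩ := (deg_pos_iff _).1 hq
  obtain ⟨b, hb, hzb⟩ := hreach v z (hH.reachable q v hx.mem_support_left z hy.mem_support_left)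
    ⟨a, ha, (P a : G.Walk v x).start_mem_support⟩
  exact hzU b hb hzb

/-- Of at least three paths, one avoids `z` and runs in a large member. Along its edges the p-degree
cannot change: both totals are k and the sum of minima is at least k. -/
theorem IsPathSystem.deg_eq_deg (hF : IsPathSystem G F k) (hk : 3 ≤ k)
    (hH : IsSystem (large F) (k : ℤ)) {p q : {i : K // 2 ≤ size F i}} {z : V} (hpq : p ≠ q)
    (hall : ∀ i, i = p ∨ i = q) (h : ∀ w, w ≠ z → tot (large F) w = k) {v y : V} (hv : v ≠ z)
    (hy : y ≠ z) : deg (large F) p v = deg (large F) p y := by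
  classical
  by_contra hne
  have hvy : v ≠ y := by rintro rfl; exact hne rfl
  obtain ⟨P, c, hP⟩ := hF.exists_family v y hvy
  have hbad : (univ.filter fun a => size F (c a) < 2).card ≤ 1 := by
    rw [Finset.card_le_one]
    intro a ha b hb
    simp only [Finset.mem_filter, Finset.mem_univ, true_and] at ha hb
    exact hP.eq_of_mem_edges (hP.mk_mem_edges_of_size_le hvy ha)
      (hP.mk_mem_edges_of_size_le hvy hb)
  have hbad' : (univ.filter fun a => z ∈ (P a : G.Walk v y).support).card ≤ 1 := by
    rw [Finset.card_le_one]
    intro a ha b hb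
    simp only [Finset.mem_filter, Finset.mem_univ, true_and] at ha hb
    by_contra hab
    rcases hP.disjoint a b hab z ha hb with h | h
    · exact hv h.symm
    · exact hy h.symm
  obtain ⟨a, ha⟩ : ∃ a, a ∉ (univ.filter fun a => size F (c a) < 2) ∪
      (univ.filter fun a => z ∈ (P a : G.Walk v y).support) := by
    by_contra hcon
    push Not at hcon
    have h1 := Finset.card_union_le (univ.filter fun a => size F (c a) < 2)
      (univ.filter fun a => z ∈ (P a : G.Walk v y).support)
    rw [Finset.eq_univ_iff_forall.2 hcon, Finset.card_univ, Fintype.card_fin] at h1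
    omega
  simp only [Finset.mem_union, Finset.mem_filter, Finset.mem_univ, true_and, not_or] at ha
  obtain ⟨d, hd, hd1, hd2⟩ := (P a : G.Walk v y).exists_boundary_dart
    {w | deg (large F) p w = deg (large F) p v} rfl (Ne.symm hne)
  have hde : s(d.fst, d.snd) ∈ (P a : G.Walk v y).edges := List.mem_map_of_mem hd
  have hz1 : d.fst ≠ z := fun h =>
    ha.2 (h ▸ (P a : G.Walk v y).fst_mem_support_of_mem_edges hde)
  have hz2 : d.snd ≠ z := fun h =>
    ha.2 (h ▸ (P a : G.Walk v y).snd_mem_support_of_mem_edges hde)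
  have huniv : (univ : Finset {i : K // 2 ≤ size F i}) = {p, q} := by
    ext i; simpa using hall i
  have h1 := hH.minSum_adj ⟨c a, not_lt.1 ha.1⟩ _ _ (hP.adj a _ _ hde)
  have h2 := h _ hz1
  have h3 := h _ hz2
  rw [tot, huniv, Finset.sum_pair hpq] at h2 h3
  rw [huniv, Finset.sum_pair hpq] at h1
  simp only [Set.mem_ofPred_eq] at hd1 hd2
  omega

/-- The lower bound for the number of edges of a path system. -/
theorem IsPathSystem.le_waste [Nontrivial V] (hF : IsPathSystem G F k)
    (hconn : ∀ i, ∀ u ∈ (F i).support, ∀ v ∈ (F i).support, (F i).Reachable u v)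
    (hk : 2 ≤ k) (hk5 : k ≤ 5) : (k : ℤ) * Fintype.card V - 2 ≤ waste (large F) := by
  classical
  by_contra hcon
  have hH := hF.isSystem hconn
  obtain ⟨p, q, z, hpq, hall, hp, hq, h⟩ := hH.exists_structure (by omega) (by omega)
    (not_le.1 hcon)
  have huniv : (univ : Finset {i : K // 2 ≤ size F i}) = {p, q} := by
    ext i; simpa using hall i
  have htot : ∀ w, tot (large F) w = deg (large F) p w + deg (large F) q w := by
    intro w
    rw [tot, huniv, Finset.sum_pair hpq]
  obtain ⟨v, hv⟩ := exists_ne z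
  have hv' := h v hv
  have hv2 := htot v
  have hk3 : 3 ≤ k := by omega
  have heq : ∀ w, w ≠ z → deg (large F) p v = deg (large F) p w := fun w hw =>
    hF.deg_eq_deg hk3 hH hpq hall (fun w hw => (h w hw).1) hv hw
  -- Two degrees of at least 2 with sum k ≤ 5: one of them equals 2.
  by_cases h2 : deg (large F) p v = 2
  · exact hF.false_of_degree_two hH hpq.symm hq hp
      fun w hw => ⟨(h w hw).1, (heq w hw).symm.trans h2⟩
  · refine hF.false_of_degree_two hH hpq hp hq fun w hw => ⟨(h w hw).1, ?_⟩
    have h3 := heq w hw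
    have h4 := htot w
    have h5 := h w hw
    omega

end System

end MonoConn

/-! ### From colourings to path systems, and the main theorem. -/

namespace MonoConn
open SimpleGraph Finset

variable {V : Type*} {G : SimpleGraph V}

/-- The colour classes of `φ`, split into their connected components. -/
def classComponent {K : Type*} (φ : G.EdgeLabeling K)
    (i : Σ c : K, (φ.labelGraph c).ConnectedComponent) : SimpleGraph V where
  Adj x y := (φ.labelGraph i.1).Adj x y ∧ (φ.labelGraph i.1).connectedComponentMk x = i.2
  symm := ⟨fun _ _ h => ⟨h.1.symm, by
    rw [← h.2]; exact ConnectedComponent.sound h.1.symm.reachable⟩⟩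
  loopless := ⟨fun _ h => h.1.ne rfl⟩

section
variable {K : Type*} (φ : G.EdgeLabeling K)

theorem classComponent_unique {i j : Σ c : K, (φ.labelGraph c).ConnectedComponent} {u v : V}
    (hi : (classComponent φ i).Adj u v) (hj : (classComponent φ j).Adj u v) : i = j := by
  obtain ⟨c, C⟩ := i
  obtain ⟨d, D⟩ := j
  obtain ⟨h1, h2⟩ := hi
  obtain ⟨h3, h4⟩ := hj
  simp only at h1 h2 h3 h4
  obtain ⟨h5, rfl⟩ := (EdgeLabeling.labelGraph_adj _ _).1 h1
  obtain ⟨h6, rfl⟩ := (EdgeLabeling.labelGraph_adj _ _).1 h3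
  rw [← h2, ← h4]

theorem classComponent_reachable (i : Σ c : K, (φ.labelGraph c).ConnectedComponent) {u v : V}
    (hu : u ∈ (classComponent φ i).support) (hv : v ∈ (classComponent φ i).support) :
    (classComponent φ i).Reachable u v := by
  obtain ⟨x, -, hu⟩ := hu
  obtain ⟨y, -, hv⟩ := hv
  obtain ⟨p⟩ := ConnectedComponent.exact (hu.trans hv.symm)
  clear hv
  induction p with
  | nil => rfl
  | @cons a b c h p ih =>
    have hadj : (classComponent φ i).Adj a b := ⟨h, hu⟩
    exact hadj.reachable.trans (ih hadj.symm.2)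

theorem IsMonoKConnected.isPathSystem {k : ℕ} (h : IsMonoKConnected φ k) :
    IsPathSystem G (classComponent φ) k where
  unique _ _ _ _ hi hj := classComponent_unique φ hi hj
  exists_family u v huv := by
    obtain ⟨P, hP, hmono, hdisj⟩ := h u v huv
    choose c hc using hmono
    refine ⟨P, fun i => ⟨c i, (φ.labelGraph (c i)).connectedComponentMk u⟩, hP, ?_, hdisj⟩
    intro i x y hxy
    have hadj : ∀ e ∈ (P i : G.Walk u v).edges, e ∈ (φ.labelGraph (c i)).edgeSet := by
      intro e he
      induction e with
      | h x y => exact (EdgeLabeling.labelGraph_adj _ _).2 ⟨_, hc i _ he⟩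
    refine ⟨hadj _ hxy, ConnectedComponent.sound ?_⟩
    have hx : x ∈ ((P i : G.Walk u v).transfer _ hadj).support := by
      rw [Walk.support_transfer]
      exact (P i : G.Walk u v).fst_mem_support_of_mem_edges hxy
    classical
    exact (Walk.reachable (Walk.takeUntil _ x hx)).symm

end

/-- One-edge members contribute 0 to Σ (e - 1), so only empty members have to be left out of the
count. -/
theorem waste_large_eq [Fintype V] {K : Type*} [Fintype K] (F : K → SimpleGraph V)
    [∀ i, Decidable (1 ≤ size F i)] :
    waste (large F) = 2 * (∑ i, size F i - (univ.filter fun i => 1 ≤ size F i).card) := by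
  classical
  have h1 : waste (large F) = ∑ i ∈ univ.filter (fun i => 2 ≤ size F i), (2 * size F i - 2) :=
    (Finset.sum_subtype _ (by simp) fun i => 2 * size F i - 2).symm
  rw [h1, Finset.sum_filter, Finset.cast_card, Finset.sum_filter, ← Finset.sum_sub_distrib,
    Finset.mul_sum]
  refine Finset.sum_congr rfl fun i _ => ?_
  have : 0 ≤ size F i := by simp [size]
  split_ifs <;> omega

/-- The components partition the edges of `G`, and by surjectivity each colour has a nonempty
component. -/
theorem waste_le [Fintype V] {r : ℕ} (φ : G.EdgeLabeling (Fin r)) (hφ : Function.Surjective φ)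
    [Fintype (Σ c : Fin r, (φ.labelGraph c).ConnectedComponent)] :
    waste (large (classComponent φ)) ≤ 2 * ((G.edgeSet.ncard : ℤ) - r) := by
  classical
  have h1 : ∑ i, size (classComponent φ) i = (G.edgeSet.ncard : ℤ) := by
    have hU : G.edgeSet.toFinset =
        univ.biUnion fun i => (classComponent φ i).edgeSet.toFinset := by
      ext e
      induction e with
      | h x y =>
        simp only [Set.mem_toFinset, Finset.mem_biUnion, Finset.mem_univ, true_and, mem_edgeSet]
        constructor
        · intro h
          exact ⟨⟨φ ⟨s(x, y), h⟩, connectedComponentMk _ x⟩,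
            (EdgeLabeling.labelGraph_adj _ _).2 ⟨h, rfl⟩, rfl⟩
        · rintro ⟨i, hi, -⟩
          exact φ.labelGraph_le hi
    rw [Set.ncard_eq_toFinset_card', hU, Finset.card_biUnion]
    · push_cast
      refine Finset.sum_congr rfl fun i _ => ?_
      rw [size, Set.ncard_eq_toFinset_card']
    · intro i _ j _ hij
      rw [Function.onFun, Finset.disjoint_left]
      intro e he he'
      induction e with
      | h x y =>
        simp only [Set.mem_toFinset, mem_edgeSet] at he he'
        exact hij (classComponent_unique φ he he')
  have h2 : r ≤ (univ.filter fun i => 1 ≤ size (classComponent φ) i).card := by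
    have h3 : ∀ c : Fin r, ∃ C, 1 ≤ size (classComponent φ) ⟨c, C⟩ := by
      intro c
      obtain ⟨⟨e, he⟩, hc⟩ := hφ c
      induction e with
      | h x y =>
        refine ⟨connectedComponentMk _ x, ?_⟩
        have hmem : s(x, y) ∈ (classComponent φ ⟨c, connectedComponentMk _ x⟩).edgeSet :=
          ⟨(EdgeLabeling.labelGraph_adj _ _).2 ⟨he, hc⟩, rfl⟩
        have := (Set.ncard_pos (Set.toFinite _)).2 ⟨_, hmem⟩
        rw [size]
        omega
    choose C hC using h3
    calc r = (univ : Finset (Fin r)).card := by simp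
      _ ≤ _ := Finset.card_le_card_of_injOn (fun c => ⟨c, C c⟩) (by simpa using hC)
        (fun c _ d _ h => congrArg Sigma.fst h)
  rw [waste_large_eq, h1]
  omega

theorem IsMonoKConnected.le_ncard_edgeSet [Fintype V] [Nontrivial V] {k r : ℕ} (hk : 2 ≤ k)
    (hk5 : k ≤ 5) {φ : G.EdgeLabeling (Fin r)} (hφ : Function.Surjective φ)
    (h : IsMonoKConnected φ k) :
    (k : ℤ) * Fintype.card V + 2 * r ≤ 2 * (G.edgeSet.ncard : ℤ) + 2 := by
  classical
  have := Fintype.ofFinite (Σ c : Fin r, (φ.labelGraph c).ConnectedComponent)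
  have h1 := h.isPathSystem.le_waste
    (fun i u hu v hv => classComponent_reachable φ i hu hv) hk hk5
  have h2 := waste_le φ hφ
  omega

/-- Giving all edges of a spanning `k`-connected subgraph the same colour and all other edges
different colours yields a monochromatic `k`-connected colouring. -/
theorem IsKConnected.mem_colourNumbers [Fintype V] {k : ℕ} (hk : 1 ≤ k) {H : SimpleGraph V}
    (hle : H ≤ G) (hH : IsKConnected H k) :
    G.edgeSet.ncard - H.edgeSet.ncard + 1 ∈ colourNumbers G k := by
  classical
  let ψ : G.edgeSet → Option ↥(G.edgeSet \ H.edgeSet) := fun e =>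
    if h : (e : Sym2 V) ∈ H.edgeSet then none else some ⟨e, e.2, h⟩
  have hcard : Nat.card (Option ↥(G.edgeSet \ H.edgeSet)) =
      G.edgeSet.ncard - H.edgeSet.ncard + 1 := by
    rw [Finite.card_option, Nat.card_coe_set_eq, Set.ncard_sdiff (edgeSet_subset_edgeSet.2 hle)]
  have hψ : Function.Surjective ψ := by
    rintro (_ | ⟨e, he, he'⟩)
    · have h1 : 1 < Fintype.card V := by have := hH.1; omega
      obtain ⟨u, v, huv⟩ := Fintype.one_lt_card_iff.1 h1
      obtain ⟨P, -, -⟩ := hH.exists_paths huv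
      have hn : ¬ (P ⟨0, hk⟩ : H.Walk u v).Nil := fun h => huv h.eq
      have hadj := Walk.adj_snd hn
      exact ⟨⟨s(u, (P ⟨0, hk⟩ : H.Walk u v).snd), hle hadj⟩,
        dif_pos (show s(u, (P ⟨0, hk⟩ : H.Walk u v).snd) ∈ H.edgeSet from hadj)⟩
    · exact ⟨⟨e, he⟩, dif_neg he'⟩
  let f := Finite.equivFinOfCardEq hcard
  refine ⟨fun e => f (ψ e), f.surjective.comp hψ, ?_⟩
  intro u v huv
  obtain ⟨P, hP, hdisj⟩ := hH.exists_paths huv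
  refine ⟨fun i => ⟨(P i : H.Walk u v).mapLe hle, (Walk.isPath_mapLe hle).2 (P i).2⟩, ?_, ?_, ?_⟩
  · intro i j hij
    apply hP
    apply Subtype.ext
    exact Walk.map_injective_of_injective (f := Hom.ofLE hle) Function.injective_id u v
      (Subtype.ext_iff.1 hij)
  · intro i
    refine ⟨f none, fun e he => congrArg f (dif_pos ?_)⟩
    exact (P i : H.Walk u v).edges_subset_edgeSet (by simpa using he)
  · intro i j hij x hx hx'
    exact hdisj i j hij x (by simpa using hx) (by simpa using hx')

end MonoConn

theorem mainTheorem3 {V : Type*} [Fintype V] (k n : ℕ) (hk : k ∈ ({2, 3, 4, 5} : Set ℕ))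
    (hkn : k < n) (hV : Fintype.card V = n) (G : SimpleGraph V)
    (hG : MonoConn.IsKConnected G k) :
    (MonoConn.colourNumbers G k).Nonempty ∧
    (MonoConn.mc G k : ℤ) ≤ (G.edgeSet.ncard : ℤ) - ⌈((k : ℚ) * (n : ℚ)) / 2⌉ + 1 ∧
    ∀ H : SimpleGraph V, H ≤ G → MonoConn.IsKConnected H k →
      (H.edgeSet.ncard : ℤ) = ⌈((k : ℚ) * (n : ℚ)) / 2⌉ →
      (MonoConn.mc G k : ℤ) = (G.edgeSet.ncard : ℤ) - ⌈((k : ℚ) * (n : ℚ)) / 2⌉ + 1 := by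
  have hk2 : 2 ≤ k ∧ k ≤ 5 := by
    rcases hk with rfl | rfl | rfl | rfl <;> norm_num
  have : Nontrivial V := Fintype.one_lt_card_iff_nontrivial.1 (by omega)
  have hne : (MonoConn.colourNumbers G k).Nonempty :=
    ⟨_, hG.mem_colourNumbers (by omega) le_rfl⟩
  have hgreat := MonoConn.isGreatest_mc G k hne
  have hupper : (MonoConn.mc G k : ℤ) ≤
      (G.edgeSet.ncard : ℤ) - ⌈((k : ℚ) * (n : ℚ)) / 2⌉ + 1 := by
    obtain ⟨φ, hφ, hmono⟩ := hgreat.1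
    have h1 := hmono.le_ncard_edgeSet hk2.1 hk2.2 hφ
    rw [hV] at h1
    have h2 : ⌈((k : ℚ) * (n : ℚ)) / 2⌉ ≤ (G.edgeSet.ncard : ℤ) - MonoConn.mc G k + 1 := by
      rw [Int.ceil_le]
      have h3 : ((k : ℚ) * n + 2 * MonoConn.mc G k) ≤ 2 * G.edgeSet.ncard + 2 := by
        exact_mod_cast h1
      push_cast
      linarith
    omega
  refine ⟨hne, hupper, fun H hle hH hcard => le_antisymm hupper ?_⟩
  have h1 := hgreat.2 (hH.mem_colourNumbers (by omega) hle)
  -- This makes the natural-number subtraction e(G) - e(H) in `h1` exact.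
  have h2 := Set.ncard_le_ncard (SimpleGraph.edgeSet_subset_edgeSet.2 hle)
  omega
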